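/- Let $n=3$, $p=-1$, $q\in\{2,4\}$. For $m,M>0$ let $\mathcal A$ be the set of (a.e. classes of) functions $u\in L^1(\mathbb R^3)$ with $\int_{\mathbb R^3}(\|x\|^q+1)|u(x)|\,dx<\infty$, $u\ge 0$, $\|u\|_\infty\le M$ and $\int_{\mathbb R^3}u\,dx=m$. A minimizer is a $u\in\mathcal A$ that minimizes over $\mathcal A$ the energy $$E(u)=\int_{\mathbb R^3\times\mathbb R^3}K(x-y)\,u(x)u(y)\,dx\,dy,\qquad K(x)=\frac{\|x\|^q}{q}-\frac{\|x\|^p}{p}=\frac{\|x\|^q}{q}+\frac1{\|x\|}.$$ A minimizer $u$ is called \emph{the} minimizer if every minimizer is a translate of $u$ (a.e.). With $|\cdot|$ the Lebesgue measure, $u$ is of phase 1 if $|\{u=M\}|=0$, of phase 2 if $0<|\{u=M\}|<m/M$, and of phase 3 if $|\{u=M\}|=m/M$. (a) Case $q=2$. If $m/M\le 4\pi/3$, then the function equal to the constant $M_1=3m/(4\pi)$ on the closed unit ball and to $0$ outside it is the minimizer; it is of phase 1 if $m/M<4\pi/3$ and of phase 3 if $m/M=4\pi/3$. Moreover, for all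 $m,M>0$ a minimizer exists, and no minimizer is of phase 2. (b) Case $q=4$. Let $a_0>0$ be given by $a_0^5=(5\sqrt{21}-21)/4$; then $4a_0^{10}+42a_0^5-21=0$. For $a_3>0$ let $$u(r)=\frac{a_3\,(3-3a_0^5+5a_0^3r^2)}{5a_0^3}\quad(0\le r\le a_0),\qquad u(r)=0\quad(r>a_0).$$ Then $u(0)>0$, $u$ is strictly increasing on $[0,a_0]$, and $u(a_0)=a_3(2a_0^5+3)/(5a_0^3)$. If $$\frac mM\le\frac{4\pi a_0^3}{2a_0^5+3},$$ then, with $a_3=5m/(4\pi)$, the radially symmetric function $x\mapsto u(\|x\|)$ is the minimizer, and it is of phase 1. -/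

import Mathlib

open MeasureTheory Set

noncomputable section

/-- The kernel `K(x) = ‖x‖ ^ q / q - ‖x‖ ^ p / p` on `ℝⁿ`, for real exponents `p < 0 < q`.
(The value at the origin plays no role below: the diagonal is a null set.) -/
def interactionKernel {n : ℕ} (p q : ℝ) (x : EuclideanSpace ℝ (Fin n)) : ℝ :=
  ‖x‖ ^ q / q - ‖x‖ ^ p / p

/-- The energy `E(u) = ∫∫ K(x - y) u(x) u(y) dx dy` over `ℝⁿ × ℝⁿ`.  For `-n < p < 0 < q` the
integral converges absolutely for every admissible `u` (see `IsAdmissible`). -/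
def interactionEnergy {n : ℕ} (p q : ℝ) (u : EuclideanSpace ℝ (Fin n) → ℝ) : ℝ :=
  ∫ z : EuclideanSpace ℝ (Fin n) × EuclideanSpace ℝ (Fin n),
    interactionKernel p q (z.1 - z.2) * u z.1 * u z.2

/-- The space `X` of integrable functions with `∫ (‖x‖ ^ q + 1) |h(x)| dx < ∞`. -/
def MemMomentSpace {n : ℕ} (q : ℝ) (h : EuclideanSpace ℝ (Fin n) → ℝ) : Prop :=
  Integrable h ∧ Integrable (fun x => (‖x‖ ^ q + 1) * |h x|)

/-- The admissible set: `u ∈ X`, `u ≥ 0`, `‖u‖_∞ ≤ M` and `∫ u = m`.  Functions stand for their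
almost everywhere classes, so the pointwise bounds are required almost everywhere. -/
structure IsAdmissible {n : ℕ} (q m M : ℝ) (u : EuclideanSpace ℝ (Fin n) → ℝ) : Prop where
  memMomentSpace : MemMomentSpace q u
  nonneg : ∀ᵐ x, 0 ≤ u x
  le_bound : ∀ᵐ x, |u x| ≤ M
  integral_eq : ∫ x, u x = m

/-- `u` is a minimizer of problem `(P)`: minimize `E` over the admissible set. -/
def IsMinimizer {n : ℕ} (p q m M : ℝ) (u : EuclideanSpace ℝ (Fin n) → ℝ) : Prop :=
  IsAdmissible q m M u ∧
    ∀ v : EuclideanSpace ℝ (Fin n) → ℝ, IsAdmissible q m M v →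
      interactionEnergy p q u ≤ interactionEnergy p q v

/-- `u` is *the* minimizer: it is a minimizer, and every minimizer is a translate of it
(almost everywhere). -/
def IsTheMinimizer {n : ℕ} (p q m M : ℝ) (u : EuclideanSpace ℝ (Fin n) → ℝ) : Prop :=
  IsMinimizer p q m M u ∧
    ∀ v : EuclideanSpace ℝ (Fin n) → ℝ, IsMinimizer p q m M v →
      ∃ c : EuclideanSpace ℝ (Fin n), v =ᵐ[volume] fun x => u (x - c)

/-- Phase 1: `|{x : u(x) = M}| = 0`. -/
def IsPhaseOne {n : ℕ} (M : ℝ) (u : EuclideanSpace ℝ (Fin n) → ℝ) : Prop :=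
  volume {x | u x = M} = 0

/-- Phase 2: `0 < |{x : u(x) = M}| < m / M`. -/
def IsPhaseTwo {n : ℕ} (m M : ℝ) (u : EuclideanSpace ℝ (Fin n) → ℝ) : Prop :=
  0 < volume {x | u x = M} ∧ volume {x | u x = M} < ENNReal.ofReal (m / M)

/-- Phase 3: `|{x : u(x) = M}| = m / M`. -/
def IsPhaseThree {n : ℕ} (m M : ℝ) (u : EuclideanSpace ℝ (Fin n) → ℝ) : Prop :=
  volume {x | u x = M} = ENNReal.ofReal (m / M)

/-- The radially symmetric function on `ℝⁿ` with radial profile `f`. -/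
def radialFunction (n : ℕ) (f : ℝ → ℝ) (x : EuclideanSpace ℝ (Fin n)) : ℝ :=
  f ‖x‖

/-- The constant profile on the unit ball: height `c` for `r ≤ 1`, and `0` for `r > 1`. -/
def unitBallProfile (c r : ℝ) : ℝ :=
  if r ≤ 1 then c else 0

/-- The radius `a₀ > 0` with `a₀ ^ 5 = (5 √21 - 21) / 4`. -/
def quarticRadius : ℝ :=
  ((5 * √21 - 21) / 4) ^ (1 / 5 : ℝ)

/-- The profile `a₃ (3 - 3 a₀⁵ + 5 a₀³ r²) / (5 a₀³)` for `r ≤ a₀`, and `0` for `r > a₀`. -/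
def quarticProfile (a₃ r : ℝ) : ℝ :=
  if r ≤ quarticRadius then
    a₃ * (3 - 3 * quarticRadius ^ 5 + 5 * quarticRadius ^ 3 * r ^ 2) / (5 * quarticRadius ^ 3)
  else 0

end

/-! The energy is a quadratic form. Writing `h = v - u` and `V` for the potential `K * u`, one has
`E(v) = E(u) + 2 ∫ V h + E(h)`. After a translation `u` and `v` have the same barycentre, so `h`
annihilates constants and coordinates. On such `h` the form of `‖x - y‖²` vanishes, and that of `‖x
- y‖⁴` is a sum of squares of second moments (`hasEnergy_norm_sq`, `hasEnergy_norm_pow_four`). The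
Coulomb form is positive definite because `1/‖x - y‖` is, up to a constant, the `dz s⁻⁵ ds`-measure
of the balls `B(z, s)` containing both points. The form is thus an integral of squares of `∫_B h`;
if it is zero, Lebesgue differentiation gives `h = 0` (`coulomb_eq_integral_sq`,
`ae_eq_zero_of_coulomb_eq_zero`).

Hence a centred admissible `u` is the minimizer, unique up to translation, as soon as `(V - c)(v -
u) ≥ 0` a.e. for some constant `c` and all admissible `v` (`isTheMinimizer_of_potential`). This
holds if `V = c` where `0 < u < M`, `V ≤ c` where `u = M` and `V ≥ c` where `u = 0`.

It remains to compute the potential of a radial density `α + β r²` cut off at radius `R`, with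
Newton's theorem for the Coulomb part (`potential_quadratic`), and to check these signs. For `q = 2`
the candidates are uniform balls: of radius one when `m / M ≤ 4π/3`, and of height `M` and larger
radius otherwise. The same criterion therefore covers all ratios and excludes phase 2. For `q = 4`
the defining equation of `a₀` is what makes the potential constant on the support. -/

noncomputable section

/-! ### Positive definiteness of the Coulomb kernel through its representation by balls. -/

/-- Euclidean three-space. -/
abbrev E3 : Type := EuclideanSpace ℝ (Fin 3)

/-- The first standard unit vector of `E3`. -/
def unitVec : E3 := EuclideanSpace.single 0 1

lemma norm_unitVec : ‖unitVec‖ = 1 := by simp [unitVec]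

lemma exists_linearIsometryEquiv_apply_eq {v w : E3} (h : ‖v‖ = ‖w‖) :
    ∃ L : E3 ≃ₗᵢ[ℝ] E3, L v = w :=
  ⟨_, Submodule.reflection_sub h⟩

/-- The volume of the intersection of two balls of equal radius scales. -/
lemma volume_inter_closedBall_eq {x y : E3} (hxy : x ≠ y) (s : ℝ) :
    volume (Metric.closedBall x s ∩ Metric.closedBall y s) =
      ENNReal.ofReal (‖x - y‖ ^ 3) *
        volume (Metric.closedBall (0 : E3) (s / ‖x - y‖) ∩
          Metric.closedBall unitVec (s / ‖x - y‖)) := by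
  have hd : 0 < ‖x - y‖ := norm_pos_iff.2 (sub_ne_zero.2 hxy)
  set d := ‖x - y‖ with hd'
  obtain ⟨L, hL⟩ := exists_linearIsometryEquiv_apply_eq (v := unitVec) (w := d⁻¹ • (y - x)) (by
    rw [norm_unitVec, norm_smul, norm_inv, Real.norm_of_nonneg hd.le, norm_sub_rev, ← hd',
      inv_mul_cancel₀ hd.ne'])
  set S := Metric.closedBall x s ∩ Metric.closedBall y s with hS
  have hSm : MeasurableSet S :=
    Metric.isClosed_closedBall.measurableSet.inter Metric.isClosed_closedBall.measurableSet
  have h1 : Metric.closedBall (0 : E3) (s / d) ∩ Metric.closedBall unitVec (s / d) =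
      L ⁻¹' ((fun z => d • z) ⁻¹' ((fun z => x + z) ⁻¹' S)) := by
    ext z
    have e1 : ‖x + d • L z - x‖ = d * ‖z‖ := by
      rw [add_sub_cancel_left, norm_smul, L.norm_map, Real.norm_of_nonneg hd.le]
    have e2 : ‖x + d • L z - y‖ = d * ‖z - unitVec‖ := by
      rw [← L.norm_map (z - unitVec), map_sub, hL]
      nth_rewrite 2 [← Real.norm_of_nonneg hd.le]
      rw [← norm_smul, smul_sub, smul_smul, mul_inv_cancel₀ hd.ne', one_smul]
      congr 1; abel
    simp only [hS, mem_inter_iff, mem_preimage, Metric.mem_closedBall, dist_eq_norm, e1, e2,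
      sub_zero, le_div_iff₀' hd]
  have hm1 : MeasurableSet ((fun z => x + z) ⁻¹' S) := (measurable_const_add x) hSm
  have hm2 : MeasurableSet ((fun z : E3 => d • z) ⁻¹' ((fun z => x + z) ⁻¹' S)) :=
    (measurable_const_smul d) hm1
  rw [h1, L.measurePreserving.measure_preimage hm2.nullMeasurableSet,
    Measure.addHaar_preimage_smul _ hd.ne', measure_preimage_add, finrank_euclideanSpace_fin,
    ← mul_assoc, ← ENNReal.ofReal_mul (by positivity), abs_of_pos (by positivity),
    mul_inv_cancel₀ (by positivity)]
  simp

/-- The measure `s⁻⁵ ds` on the half-line of radii. -/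
def radiusMeasure : Measure ℝ :=
  (volume.restrict (Ioi 0)).withDensity fun s => ENNReal.ofReal ((s ^ 5)⁻¹)

instance : SFinite radiusMeasure := by unfold radiusMeasure; infer_instance

lemma measurable_radiusDensity : Measurable fun s : ℝ => ENNReal.ofReal ((s ^ 5)⁻¹) := by
  fun_prop

/-- The set of pairs (centre, radius) whose ball contains `x`. -/
def ballsThrough (x : E3) : Set (E3 × ℝ) := {p | ‖x - p.1‖ ≤ p.2}

lemma measurableSet_ballsThrough (x : E3) : MeasurableSet (ballsThrough x) :=
  measurableSet_le (by fun_prop) (by fun_prop)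

/-- The constant in the ball representation of the Coulomb kernel. -/
def ballConst : ENNReal :=
  (volume.prod radiusMeasure) (ballsThrough 0 ∩ ballsThrough unitVec)

lemma prod_ballsThrough_inter (x y : E3) :
    (volume.prod radiusMeasure) (ballsThrough x ∩ ballsThrough y) =
      ∫⁻ s in Ioi 0, ENNReal.ofReal ((s ^ 5)⁻¹) *
        volume (Metric.closedBall x s ∩ Metric.closedBall y s) := by
  rw [Measure.prod_apply_symm
    ((measurableSet_ballsThrough x).inter (measurableSet_ballsThrough y)), radiusMeasure,
    lintegral_withDensity_eq_lintegral_mul₀]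
  · refine lintegral_congr fun s => ?_
    simp only [Pi.mul_apply]
    congr 2
    ext z
    simp [ballsThrough, dist_eq_norm, norm_sub_rev z]
  · exact measurable_radiusDensity.aemeasurable
  · exact (measurable_measure_prodMk_right
      ((measurableSet_ballsThrough x).inter (measurableSet_ballsThrough y))).aemeasurable

/-- Scaling fixes the exponent `-5`: with `s = d t` the density `s⁻⁵ ds` contributes `d⁻⁴` and the
volume of the lens `d³`, which leaves `d⁻¹`. -/
lemma prod_ballsThrough_inter_eq {x y : E3} (hxy : x ≠ y) :
    (volume.prod radiusMeasure) (ballsThrough x ∩ ballsThrough y) =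
      ENNReal.ofReal ‖x - y‖⁻¹ * ballConst := by
  have hd : 0 < ‖x - y‖ := norm_pos_iff.2 (sub_ne_zero.2 hxy)
  rw [ballConst, prod_ballsThrough_inter, prod_ballsThrough_inter]
  set d := ‖x - y‖ with hd'
  have him : (fun t : ℝ => d * t) '' Ioi 0 = Ioi 0 := by
    rw [image_mul_left_Ioi hd, mul_zero]
  conv_lhs => rw [← him]
  rw [lintegral_image_eq_lintegral_abs_deriv_mul (f' := fun _ => d) measurableSet_Ioi
      (fun t _ => by simpa using ((hasDerivAt_id t).const_mul d).hasDerivWithinAt)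
      (mul_right_injective₀ hd.ne').injOn,
    ← lintegral_const_mul' _ _ ENNReal.ofReal_ne_top]
  refine setLIntegral_congr_fun measurableSet_Ioi fun t ht => ?_
  have ht : 0 < t := ht
  rw [volume_inter_closedBall_eq hxy, ← hd', mul_div_cancel_left₀ _ hd.ne', abs_of_pos hd,
    ← mul_assoc, ← mul_assoc, ← mul_assoc, ← ENNReal.ofReal_mul hd.le,
    ← ENNReal.ofReal_mul (by positivity), ← ENNReal.ofReal_mul (by positivity)]
  congr 2
  field_simp

/-- Small radii contribute nothing, since balls of radius at most `1/3` about points at distance one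
are disjoint. For large radii the integrand is at most a multiple of `s⁻⁵ s³ = s⁻²`. -/
lemma ballConst_ne_top : ballConst ≠ ⊤ := by
  rw [ballConst, prod_ballsThrough_inter]
  set c : ENNReal := volume (Metric.ball (0 : E3) 1)
  have hle : ∀ s ∈ Ioi (0 : ℝ), ENNReal.ofReal ((s ^ 5)⁻¹) *
      volume (Metric.closedBall (0 : E3) s ∩ Metric.closedBall unitVec s) ≤
      (Ioi (1 / 3 : ℝ)).indicator (fun s => ENNReal.ofReal (s ^ (-2 : ℝ)) * c) s := by
    intro s hs
    have hs : 0 < s := hs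
    by_cases h : s ∈ Ioi (1 / 3 : ℝ)
    · rw [indicator_of_mem h]
      refine (mul_le_mul_right (measure_mono inter_subset_left) _).trans ?_
      rw [Measure.addHaar_closedBall _ _ hs.le, finrank_euclideanSpace_fin, ← mul_assoc,
        ← ENNReal.ofReal_mul (by positivity)]
      refine le_of_eq ?_
      congr 2
      rw [Real.rpow_neg hs.le]
      norm_num
      field_simp
    · have : Metric.closedBall (0 : E3) s ∩ Metric.closedBall unitVec s = ∅ := by
        ext z
        simp only [mem_inter_iff, Metric.mem_closedBall, dist_eq_norm, sub_zero,
          mem_empty_iff_false, iff_false, not_and]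
        intro h1 h2
        have h3 := norm_sub_norm_le unitVec z
        rw [norm_unitVec, norm_sub_rev] at h3
        simp only [mem_Ioi, not_lt] at h
        linarith
      simp [this]
  refine ((setLIntegral_mono' measurableSet_Ioi hle).trans_lt ?_).ne
  refine (setLIntegral_le_lintegral _ _).trans_lt ?_
  rw [lintegral_indicator measurableSet_Ioi, lintegral_mul_const' _ _ measure_ball_lt_top.ne]
  refine ENNReal.mul_lt_top ?_ measure_ball_lt_top
  exact (integrableOn_Ioi_rpow_of_lt (by norm_num) (by norm_num)).lintegral_lt_top

/-- For radii in `(2, 3)` both balls contain the unit ball about the origin. -/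
lemma ballConst_ne_zero : ballConst ≠ 0 := by
  rw [ballConst, prod_ballsThrough_inter]
  refine ne_of_gt ?_
  have h0 : 0 < ∫⁻ s in Ioo (2 : ℝ) 3, ENNReal.ofReal ((3 ^ 5)⁻¹) *
      volume (Metric.closedBall (0 : E3) 1) := by
    rw [lintegral_const]
    refine ENNReal.mul_pos (mul_ne_zero (by simp) ?_) (by simp; norm_num)
    exact (Metric.measure_closedBall_pos _ _ one_pos).ne'
  refine h0.trans_le ((setLIntegral_mono' measurableSet_Ioo fun s hs => ?_).trans
    (lintegral_mono_set (Ioo_subset_Ioi_self.trans (Ioi_subset_Ioi (by norm_num)))))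
  have hs0 : (0 : ℝ) < s := by linarith [hs.1]
  refine mul_le_mul' (ENNReal.ofReal_le_ofReal ?_) (measure_mono fun z hz => ?_)
  · gcongr
    exact hs.2.le
  · simp only [mem_inter_iff, Metric.mem_closedBall, dist_eq_norm, sub_zero] at hz ⊢
    have := norm_sub_le z unitVec
    rw [norm_unitVec] at this
    constructor <;> linarith [hs.1]

/-- The indicator of `ballsThrough x` as a real function. -/
def ballIndicator (x : E3) (p : E3 × ℝ) : ℝ := (ballsThrough x).indicator 1 p

lemma measurable_ballIndicator :
    Measurable fun z : E3 × (E3 × ℝ) => ballIndicator z.1 z.2 := by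
  have h : MeasurableSet {z : E3 × (E3 × ℝ) | ‖z.1 - z.2.1‖ ≤ z.2.2} :=
    measurableSet_le (by fun_prop) (by fun_prop)
  exact (measurable_const (a := (1 : ℝ))).indicator h

lemma ballIndicator_nonneg (x : E3) (p : E3 × ℝ) : 0 ≤ ballIndicator x p :=
  indicator_nonneg (fun _ _ => zero_le_one) _

lemma ballIndicator_mul (x y : E3) (p : E3 × ℝ) :
    ballIndicator x p * ballIndicator y p = (ballsThrough x ∩ ballsThrough y).indicator 1 p := by
  rw [inter_indicator_one]; rfl

lemma integrable_ballIndicator_mul {x y : E3} (hxy : x ≠ y) :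
    Integrable (fun p => ballIndicator x p * ballIndicator y p) (volume.prod radiusMeasure) := by
  simp only [ballIndicator_mul]
  refine (integrable_indicator_iff
    ((measurableSet_ballsThrough x).inter (measurableSet_ballsThrough y))).2 ?_
  refine (integrableOn_const_iff (C := (1 : ℝ))).2 (Or.inr ?_)
  rw [prod_ballsThrough_inter_eq hxy]
  exact ENNReal.mul_lt_top ENNReal.ofReal_lt_top ballConst_ne_top.lt_top

lemma integral_ballIndicator_mul {x y : E3} (hxy : x ≠ y) :
    ∫ p, ballIndicator x p * ballIndicator y p ∂(volume.prod radiusMeasure) =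
      ballConst.toReal * ‖x - y‖⁻¹ := by
  simp only [ballIndicator_mul]
  rw [integral_indicator_one
    ((measurableSet_ballsThrough x).inter (measurableSet_ballsThrough y)), Measure.real,
    prod_ballsThrough_inter_eq hxy, ENNReal.toReal_mul, ENNReal.toReal_ofReal (by positivity),
    mul_comm]

lemma ae_ne_of_prod : ∀ᵐ z : E3 × E3, z.1 ≠ z.2 := by
  have hm : MeasurableSet {z : E3 × E3 | z.1 ≠ z.2} :=
    (isClosed_eq continuous_fst continuous_snd).measurableSet.compl
  rw [Measure.volume_eq_prod]
  refine (Measure.ae_prod_iff_ae_ae hm).2 (Filter.Eventually.of_forall fun x => ?_)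
  filter_upwards [Measure.ae_ne volume x] with y hy using hy.symm

/-- This licenses Fubini in `coulomb_eq_integral_sq`: integrating the absolute value over the balls
first gives back the Coulomb integrand of `|h|`, off the null diagonal. -/
lemma integrable_ball_coulomb {h : E3 → ℝ} (hm : AEStronglyMeasurable h)
    (hh : Integrable fun z : E3 × E3 => ‖z.1 - z.2‖⁻¹ * h z.1 * h z.2) :
    Integrable (fun w : (E3 × E3) × (E3 × ℝ) =>
      (ballIndicator w.1.1 w.2 * h w.1.1) * (ballIndicator w.1.2 w.2 * h w.1.2))
      ((volume : Measure (E3 × E3)).prod (volume.prod radiusMeasure)) := by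
  have hm1 : AEStronglyMeasurable (fun z : E3 × E3 => h z.1) := by
    rw [Measure.volume_eq_prod]; exact hm.comp_fst
  have hm2 : AEStronglyMeasurable (fun z : E3 × E3 => h z.2) := by
    rw [Measure.volume_eq_prod]; exact hm.comp_snd
  have hb1 : Measurable fun w : (E3 × E3) × (E3 × ℝ) => ballIndicator w.1.1 w.2 := by
    have h1 : Measurable fun w : (E3 × E3) × (E3 × ℝ) => (w.1.1, w.2) := by fun_prop
    exact (measurable_ballIndicator.comp h1 :)
  have hb2 : Measurable fun w : (E3 × E3) × (E3 × ℝ) => ballIndicator w.1.2 w.2 := by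
    have h1 : Measurable fun w : (E3 × E3) × (E3 × ℝ) => (w.1.2, w.2) := by fun_prop
    exact (measurable_ballIndicator.comp h1 :)
  have hm : AEStronglyMeasurable (fun w : (E3 × E3) × (E3 × ℝ) =>
      (ballIndicator w.1.1 w.2 * h w.1.1) * (ballIndicator w.1.2 w.2 * h w.1.2))
      ((volume : Measure (E3 × E3)).prod (volume.prod radiusMeasure)) := by
    refine AEStronglyMeasurable.mul ?_ ?_
    · exact AEStronglyMeasurable.mul hb1.aestronglyMeasurable
        (AEStronglyMeasurable.comp_fst (f := fun z : E3 × E3 => h z.1) hm1)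
    · exact AEStronglyMeasurable.mul hb2.aestronglyMeasurable
        (AEStronglyMeasurable.comp_fst (f := fun z : E3 × E3 => h z.2) hm2)
  refine (integrable_prod_iff hm).2 ⟨?_, ?_⟩
  · filter_upwards [ae_ne_of_prod] with z hz
    refine ((integrable_ballIndicator_mul hz).mul_const (h z.1 * h z.2)).congr
      (Filter.Eventually.of_forall fun p => ?_)
    simp only
    ring
  · refine ((hh.norm.const_mul ballConst.toReal)).congr ?_
    filter_upwards [ae_ne_of_prod] with z hz
    have : ∀ p, ‖(ballIndicator z.1 p * h z.1) * (ballIndicator z.2 p * h z.2)‖ =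
        (ballIndicator z.1 p * ballIndicator z.2 p) * (|h z.1| * |h z.2|) := by
      intro p
      rw [norm_mul, norm_mul, norm_mul, Real.norm_of_nonneg (ballIndicator_nonneg _ _),
        Real.norm_of_nonneg (ballIndicator_nonneg _ _), Real.norm_eq_abs, Real.norm_eq_abs]
      ring
    simp only [this]
    rw [integral_mul_const, integral_ballIndicator_mul hz, norm_mul, norm_mul, norm_inv, norm_norm,
      Real.norm_eq_abs, Real.norm_eq_abs]
    ring

/-- For a fixed ball the integrand is a product of a function of `x` and the same function of `y`,
so the double integral is a square. -/
lemma coulomb_eq_integral_sq {h : E3 → ℝ} (hm : AEStronglyMeasurable h)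
    (hh : Integrable fun z : E3 × E3 => ‖z.1 - z.2‖⁻¹ * h z.1 * h z.2) :
    Integrable (fun p => (∫ x, ballIndicator x p * h x) ^ 2) (volume.prod radiusMeasure) ∧
    ballConst.toReal * ∫ z : E3 × E3, ‖z.1 - z.2‖⁻¹ * h z.1 * h z.2 =
      ∫ p, (∫ x, ballIndicator x p * h x) ^ 2 ∂(volume.prod radiusMeasure) := by
  have hi := integrable_ball_coulomb hm hh
  have hprod : ∀ p : E3 × ℝ, ∫ z : E3 × E3,
      (ballIndicator z.1 p * h z.1) * (ballIndicator z.2 p * h z.2) =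
      (∫ x, ballIndicator x p * h x) ^ 2 := fun p => by
    rw [Measure.volume_eq_prod, sq]
    exact integral_prod_mul (fun x => ballIndicator x p * h x) (fun x => ballIndicator x p * h x)
  constructor
  · have := hi.integral_prod_right
    exact this.congr (Filter.Eventually.of_forall hprod)
  · simp only [← hprod]
    rw [← integral_integral_swap hi, ← integral_const_mul]
    refine integral_congr_ae ?_
    filter_upwards [ae_ne_of_prod] with z hz
    have : ∀ p, (ballIndicator z.1 p * h z.1) * (ballIndicator z.2 p * h z.2) =
        (ballIndicator z.1 p * ballIndicator z.2 p) * (h z.1 * h z.2) := fun p => by ring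
    simp only [this]
    rw [integral_mul_const, integral_ballIndicator_mul hz]
    ring

lemma ballConst_toReal_pos : 0 < ballConst.toReal :=
  ENNReal.toReal_pos ballConst_ne_zero ballConst_ne_top

/-- The Coulomb energy is nonnegative. -/
theorem coulomb_nonneg {h : E3 → ℝ} (hm : AEStronglyMeasurable h)
    (hh : Integrable fun z : E3 × E3 => ‖z.1 - z.2‖⁻¹ * h z.1 * h z.2) :
    0 ≤ ∫ z : E3 × E3, ‖z.1 - z.2‖⁻¹ * h z.1 * h z.2 := by
  refine nonneg_of_mul_nonneg_right ?_ ballConst_toReal_pos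
  rw [(coulomb_eq_integral_sq hm hh).2]
  exact integral_nonneg fun p => sq_nonneg _

/-- The Coulomb energy vanishes only at zero. -/
theorem ae_eq_zero_of_coulomb_eq_zero {h : E3 → ℝ} (hint : Integrable h)
    (hh : Integrable fun z : E3 × E3 => ‖z.1 - z.2‖⁻¹ * h z.1 * h z.2)
    (h0 : ∫ z : E3 × E3, ‖z.1 - z.2‖⁻¹ * h z.1 * h z.2 = 0) : h =ᵐ[volume] 0 := by
  obtain ⟨hi, he⟩ := coulomb_eq_integral_sq hint.aestronglyMeasurable hh
  rw [h0, mul_zero] at he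
  have hz := (integral_eq_zero_iff_of_nonneg (fun p => sq_nonneg _) hi).1 he.symm
  have hz' := Measure.ae_ae_of_ae_prod hz
  filter_upwards [hz', IsUnifLocDoublingMeasure.ae_tendsto_average volume
    hint.locallyIntegrable 1] with z h1 h2
  -- The density `s⁻⁵` is positive on the half-line, so null sets for `radiusMeasure` are null for
  -- Lebesgue measure there.
  have h3 : ∀ᵐ s ∂(volume.restrict (Ioi (0 : ℝ))), ∫ x in Metric.closedBall z s, h x = 0 := by
    rw [radiusMeasure, ae_withDensity_iff measurable_radiusDensity] at h1
    filter_upwards [h1, ae_restrict_mem measurableSet_Ioi] with s hs hs0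
    have hs0 : 0 < s := hs0
    have h4 := hs (by simpa using pow_pos hs0 5)
    simp only [Pi.zero_apply, ne_eq, OfNat.ofNat_ne_zero, not_false_eq_true,
      pow_eq_zero_iff] at h4
    rw [← integral_indicator Metric.isClosed_closedBall.measurableSet, ← h4]
    refine integral_congr_ae (Filter.Eventually.of_forall fun x => ?_)
    by_cases hx : x ∈ Metric.closedBall z s
    · have hx' : (z, s) ∈ ballsThrough x := by
        simpa [ballsThrough, dist_eq_norm] using hx
      simp [hx, ballIndicator, hx']
    · have hx' : (z, s) ∉ ballsThrough x := by
        simpa [ballsThrough, dist_eq_norm] using hx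
      simp [hx, ballIndicator, hx']
  -- Almost every radius is good, so good radii tending to zero exist; along them the averages of
  -- `h` over balls about `z` are zero and converge to `h z`.
  have h4 : ∀ n : ℕ, ∃ s ∈ Ioo (0 : ℝ) (1 / (n + 1)),
      ∫ x in Metric.closedBall z s, h x = 0 := by
    intro n
    have hpos : (0 : ℝ) < 1 / (n + 1) := by positivity
    have h5 : ∀ᵐ s ∂(volume.restrict (Ioo (0 : ℝ) (1 / (n + 1)))),
        ∫ x in Metric.closedBall z s, h x = 0 :=
      ae_restrict_of_ae_restrict_of_subset Ioo_subset_Ioi_self h3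
    have : Filter.NeBot (ae (volume.restrict (Ioo (0 : ℝ) (1 / (n + 1))))) := by
      rw [ae_neBot, Ne, Measure.restrict_eq_zero, Real.volume_Ioo]
      simpa using hpos
    obtain ⟨s, hs1, hs2⟩ := (h5.and (ae_restrict_mem measurableSet_Ioo)).exists
    exact ⟨s, hs2, hs1⟩
  choose s hs hs0 using h4
  have hlim : Filter.Tendsto s Filter.atTop (nhdsWithin 0 (Ioi 0)) := by
    refine tendsto_nhdsWithin_iff.2 ⟨?_, Filter.Eventually.of_forall fun n => (hs n).1⟩
    exact squeeze_zero (fun n => (hs n).1.le) (fun n => (hs n).2.le)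
      tendsto_one_div_add_atTop_nhds_zero_nat
  have h5 := h2 (fun _ => z) s hlim (Filter.Eventually.of_forall fun n => by
    simpa using (hs n).1.le)
  have h6 : ∀ n, (⨍ y in Metric.closedBall z (s n), h y) = 0 := fun n => by
    rw [setAverage_eq, hs0, smul_zero]
  simp only [h6] at h5
  exact (tendsto_nhds_unique h5 tendsto_const_nhds)

/-! ### Integration of functions of `‖y‖` and `‖x - y‖`. -/

lemma lintegral_sqrt_sq_add_sq {g : ℝ → ENNReal} (hg : Measurable g) :
    ∫⁻ p : ℝ × ℝ, g √(p.1 ^ 2 + p.2 ^ 2) =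
      ENNReal.ofReal (2 * Real.pi) * ∫⁻ ρ in Ioi 0, ENNReal.ofReal ρ * g ρ := by
  rw [← lintegral_comp_polarCoord_symm, polarCoord_target, Measure.volume_eq_prod,
    ← Measure.prod_restrict, lintegral_prod _ (by simp only [smul_eq_mul]; fun_prop),
    ← lintegral_const_mul' _ _ ENNReal.ofReal_ne_top]
  refine setLIntegral_congr_fun measurableSet_Ioi fun ρ hρ => ?_
  have hρ : 0 < ρ := hρ
  have h : ∀ θ : ℝ, √((ρ * Real.cos θ) ^ 2 + (ρ * Real.sin θ) ^ 2) = ρ := fun θ => by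
    rw [show (ρ * Real.cos θ) ^ 2 + (ρ * Real.sin θ) ^ 2 = ρ ^ 2 by
      linear_combination ρ ^ 2 * Real.sin_sq_add_cos_sq θ, Real.sqrt_sq hρ.le]
  simp only [polarCoord_symm_apply, h, lintegral_const, Measure.restrict_apply_univ,
    Real.volume_Ioo, smul_eq_mul]
  rw [mul_comm]
  congr 2
  ring

lemma lintegral_cylinder {G : ℝ → ℝ → ENNReal} (hG : Measurable (Function.uncurry G)) :
    ∫⁻ y : E3, G (y 0) √((y 1) ^ 2 + (y 2) ^ 2) =
      ENNReal.ofReal (2 * Real.pi) * ∫⁻ t, ∫⁻ ρ in Ioi 0, ENNReal.ofReal ρ * G t ρ := by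
  have h1 := (PiLp.volume_preserving_ofLp (Fin 3)).lintegral_comp
    (f := fun y : Fin 3 → ℝ => G (y 0) √((y 1) ^ 2 + (y 2) ^ 2)) (by fun_prop)
  have h2 := (volume_preserving_piFinSuccAbove (fun _ : Fin 3 => ℝ) 0).lintegral_comp
    (f := fun z : ℝ × (Fin 2 → ℝ) => G z.1 √((z.2 0) ^ 2 + (z.2 1) ^ 2)) (by fun_prop)
  refine h1.trans (h2.trans ?_)
  rw [Measure.volume_eq_prod, lintegral_prod _ (by fun_prop),
    ← lintegral_const_mul' _ _ ENNReal.ofReal_ne_top]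
  refine lintegral_congr fun t => ?_
  have hGt : Measurable (G t) := hG.of_uncurry_left
  have h3 := (volume_preserving_piFinTwo (fun _ : Fin 2 => ℝ)).lintegral_comp
    (f := fun z : ℝ × ℝ => G t √(z.1 ^ 2 + z.2 ^ 2)) (by fun_prop)
  exact h3.trans (lintegral_sqrt_sq_add_sq hGt)

/-- Substitution `s = √(t² + ρ²)`, for which `s ds = ρ dρ`; it replaces the distance to the axis by
the distance to the origin. -/
lemma lintegral_Ioi_sqrt_sq_add_sq (t : ℝ) (g : ℝ → ENNReal) :
    ∫⁻ ρ in Ioi 0, ENNReal.ofReal ρ * g √(t ^ 2 + ρ ^ 2) =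
      ∫⁻ s in Ioi |t|, ENNReal.ofReal s * g s := by
  have him : (fun ρ : ℝ => √(t ^ 2 + ρ ^ 2)) '' Ioi 0 = Ioi |t| := by
    ext s
    simp only [mem_image, mem_Ioi]
    constructor
    · rintro ⟨ρ, hρ, rfl⟩
      rw [← Real.sqrt_sq_eq_abs]
      exact Real.sqrt_lt_sqrt (sq_nonneg _) (by nlinarith)
    · intro hs
      have h0 : 0 < s := (abs_nonneg t).trans_lt hs
      have h1 : t ^ 2 < s ^ 2 := by
        rw [← sq_abs t]; exact pow_lt_pow_left₀ hs (abs_nonneg t) two_ne_zero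
      refine ⟨√(s ^ 2 - t ^ 2), Real.sqrt_pos.2 (by linarith), ?_⟩
      rw [Real.sq_sqrt (by linarith), add_sub_cancel, Real.sqrt_sq h0.le]
  rw [← him, lintegral_image_eq_lintegral_abs_deriv_mul
    (f' := fun ρ => ρ / √(t ^ 2 + ρ ^ 2)) measurableSet_Ioi]
  · refine setLIntegral_congr_fun measurableSet_Ioi fun ρ hρ => ?_
    have hρ : 0 < ρ := hρ
    have hs : 0 < √(t ^ 2 + ρ ^ 2) := Real.sqrt_pos.2 (by positivity)
    rw [← mul_assoc, ← ENNReal.ofReal_mul (abs_nonneg _), abs_of_pos (by positivity),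
      div_mul_cancel₀ _ hs.ne']
  · intro ρ hρ
    have hρ : 0 < ρ := hρ
    have h := (((hasDerivAt_id ρ).pow 2).const_add (t ^ 2)).sqrt (by simp; positivity)
    refine HasDerivAt.hasDerivWithinAt ?_
    convert! h using 1
    simp
    field_simp
  · intro a ha b hb hab
    have ha : 0 < a := ha
    have hb : 0 < b := hb
    have := (Real.sqrt_inj (by positivity) (by positivity)).1 hab
    nlinarith

/-- Integration of a function of the distances to the origin and to a point `x`. -/
theorem lintegral_norm_mul_norm_sub {f k : ℝ → ENNReal} (hf : Measurable f) (hk : Measurable k)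
    (x : E3) :
    ∫⁻ y : E3, f ‖y‖ * k ‖x - y‖ = ENNReal.ofReal (2 * Real.pi) *
      ∫⁻ s in Ioi 0, ENNReal.ofReal s * f s *
        ∫⁻ t in Ioo (-s) s, k √(s ^ 2 + ‖x‖ ^ 2 - 2 * t * ‖x‖) := by
  set r := ‖x‖ with hr
  have hr0 : 0 ≤ r := norm_nonneg x
  -- An isometry puts `x` on the first axis, so that both distances depend only on the axial
  -- coordinate `t` and the distance to the axis.
  obtain ⟨L, hL⟩ := exists_linearIsometryEquiv_apply_eq (v := r • unitVec) (w := x) (by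
    rw [norm_smul, norm_unitVec, mul_one, Real.norm_of_nonneg hr0])
  rw [← L.measurePreserving.lintegral_comp (by fun_prop)]
  have h1 : ∀ y : E3, f ‖L y‖ * k ‖x - L y‖ =
      (fun t ρ : ℝ => f √(t ^ 2 + ρ ^ 2) * k √(t ^ 2 + ρ ^ 2 + r ^ 2 - 2 * t * r))
        (y 0) √((y 1) ^ 2 + (y 2) ^ 2) := by
    intro y
    have e1 : ‖L y‖ = √((y 0) ^ 2 + √((y 1) ^ 2 + (y 2) ^ 2) ^ 2) := by
      rw [L.norm_map, Real.sq_sqrt (by positivity), EuclideanSpace.norm_eq]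
      congr 1
      simp [Fin.sum_univ_three]
      ring
    have e2 : ‖x - L y‖ =
        √((y 0) ^ 2 + √((y 1) ^ 2 + (y 2) ^ 2) ^ 2 + r ^ 2 - 2 * (y 0) * r) := by
      rw [← hL, ← map_sub, L.norm_map, Real.sq_sqrt (by positivity), EuclideanSpace.norm_eq]
      congr 1
      simp [Fin.sum_univ_three, unitVec]
      ring
    rw [e1, e2]
  rw [lintegral_congr h1, lintegral_cylinder (G := fun t ρ : ℝ =>
    f √(t ^ 2 + ρ ^ 2) * k √(t ^ 2 + ρ ^ 2 + r ^ 2 - 2 * t * r)) (by fun_prop)]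
  congr 1
  -- After the swap of `t` and `s` the condition `|t| < s` leaves a uniform weight in `t` on `(-s,
  -- s)`: this is Archimedes' hat-box theorem.
  set g : ℝ → ℝ → ENNReal := fun t s => ENNReal.ofReal s *
    (f s * k √(s ^ 2 + r ^ 2 - 2 * t * r)) with hg
  have h2 : ∀ t : ℝ, ∫⁻ ρ in Ioi 0, ENNReal.ofReal ρ * (f √(t ^ 2 + ρ ^ 2) *
        k √(t ^ 2 + ρ ^ 2 + r ^ 2 - 2 * t * r)) = ∫⁻ s, (Ioi |t|).indicator (g t) s := by
    intro t
    have h3 := lintegral_Ioi_sqrt_sq_add_sq t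
      (fun s => f s * k √(s ^ 2 + r ^ 2 - 2 * t * r))
    have h4 : ∀ ρ : ℝ, √(t ^ 2 + ρ ^ 2) ^ 2 = t ^ 2 + ρ ^ 2 := fun ρ =>
      Real.sq_sqrt (by positivity)
    simp only [h4] at h3
    rw [h3, ← lintegral_indicator measurableSet_Ioi]
  have hmeas : Measurable (Function.uncurry fun t s : ℝ => (Ioi |t|).indicator (g t) s) := by
    have hS : MeasurableSet {p : ℝ × ℝ | |p.1| < p.2} :=
      measurableSet_lt (by fun_prop) (by fun_prop)
    have hg' : Measurable fun p : ℝ × ℝ => g p.1 p.2 := by fun_prop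
    exact hg'.indicator hS
  rw [lintegral_congr h2, lintegral_lintegral_swap hmeas.aemeasurable,
    ← lintegral_indicator measurableSet_Ioi]
  refine lintegral_congr fun s => ?_
  by_cases hs : 0 < s
  · rw [indicator_of_mem (mem_Ioi.2 hs), ← lintegral_const_mul _ (by fun_prop),
      ← lintegral_indicator measurableSet_Ioo]
    refine lintegral_congr fun t => ?_
    by_cases ht : |t| < s
    · rw [indicator_of_mem (mem_Ioi.2 ht), indicator_of_mem (mem_Ioo.2 (abs_lt.1 ht)), hg, mul_assoc]
    · rw [indicator_of_notMem (by simpa using ht),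
        indicator_of_notMem (fun h => ht (abs_lt.2 (mem_Ioo.1 h)))]
  · have h0 : ∀ t : ℝ, (Ioi |t|).indicator (g t) s = 0 := fun t =>
      indicator_of_notMem (fun h => hs ((abs_nonneg t).trans_lt h)) _
    simp [h0, hs]

/-- Integration of a real function of the distances to the origin and to a point `x`. -/
theorem integral_norm_mul_norm_sub {f k I : ℝ → ℝ} (hf : Measurable f) (hk : Measurable k)
    (hf0 : ∀ s, 0 ≤ f s) (hk0 : ∀ s, 0 ≤ s → 0 ≤ k s) (hI : Measurable I) (x : E3)
    (hint : ∀ s, 0 < s →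
      IntegrableOn (fun t => k √(s ^ 2 + ‖x‖ ^ 2 - 2 * t * ‖x‖)) (Ioo (-s) s))
    (heq : ∀ s, 0 < s → ∫ t in Ioo (-s) s, k √(s ^ 2 + ‖x‖ ^ 2 - 2 * t * ‖x‖) = I s) :
    ∫ y : E3, k ‖x - y‖ * f ‖y‖ = 2 * Real.pi * ∫ s in Ioi 0, s * f s * I s := by
  have hI0 : ∀ s, 0 < s → 0 ≤ I s := fun s hs => by
    rw [← heq s hs]; exact integral_nonneg fun t => hk0 _ (Real.sqrt_nonneg _)
  have h := lintegral_norm_mul_norm_sub hf.ennreal_ofReal hk.ennreal_ofReal x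
  rw [integral_eq_lintegral_of_nonneg_ae, integral_eq_lintegral_of_nonneg_ae]
  · have e1 : ∫⁻ y : E3, ENNReal.ofReal (k ‖x - y‖ * f ‖y‖) =
        ∫⁻ y : E3, ENNReal.ofReal (f ‖y‖) * ENNReal.ofReal (k ‖x - y‖) :=
      lintegral_congr fun y => by rw [mul_comm, ENNReal.ofReal_mul (hf0 _)]
    rw [e1, h, ENNReal.toReal_mul, ENNReal.toReal_ofReal (by positivity)]
    congr 2
    refine setLIntegral_congr_fun measurableSet_Ioi fun s hs => ?_
    have hs : 0 < s := hs
    rw [← ofReal_integral_eq_lintegral_ofReal (hint s hs)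
      (Filter.Eventually.of_forall fun t => hk0 _ (Real.sqrt_nonneg _)), heq s hs,
      ← ENNReal.ofReal_mul hs.le, ← ENNReal.ofReal_mul (mul_nonneg hs.le (hf0 s))]
  · filter_upwards [ae_restrict_mem measurableSet_Ioi] with s hs
    exact mul_nonneg (mul_nonneg (le_of_lt hs) (hf0 s)) (hI0 s hs)
  · exact (by fun_prop : Measurable fun s => s * f s * I s).aestronglyMeasurable
  · exact Filter.Eventually.of_forall fun y => mul_nonneg (hk0 _ (norm_nonneg _)) (hf0 _)
  · exact (by fun_prop : Measurable fun y : E3 => k ‖x - y‖ * f ‖y‖).aestronglyMeasurable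

/-- Newton's theorem: a uniform sphere of radius `s` acts as a point mass at its centre when seen
from outside, and has constant potential inside. For `r > 0` the primitive in `t` is `-√(s² + r² -
2tr) / r`. -/
lemma integral_Ioo_sqrt_inv {r s : ℝ} (hr : 0 ≤ r) (hs : 0 < s) :
    IntegrableOn (fun t => (√(s ^ 2 + r ^ 2 - 2 * t * r))⁻¹) (Ioo (-s) s) ∧
    ∫ t in Ioo (-s) s, (√(s ^ 2 + r ^ 2 - 2 * t * r))⁻¹ = 2 * s / max r s := by
  rcases hr.eq_or_lt with rfl | hr
  · have h : ∀ t : ℝ, (√(s ^ 2 + 0 ^ 2 - 2 * t * 0))⁻¹ = s⁻¹ := fun t => by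
      simp [Real.sqrt_sq hs.le]
    simp only [h]
    refine ⟨by simp, ?_⟩
    rw [max_eq_right hs.le, setIntegral_const, Real.volume_real_Ioo_of_le (by linarith)]
    simp only [smul_eq_mul]
    ring
  · have hw : ∀ t ∈ Ioo (-s) s, 0 < s ^ 2 + r ^ 2 - 2 * t * r := fun t ht => by
      nlinarith [sq_nonneg (s - r), mul_pos hr (sub_pos.2 ht.2)]
    have hc : ContinuousOn (fun t => -√(s ^ 2 + r ^ 2 - 2 * t * r) / r) (Icc (-s) s) :=
      Continuous.continuousOn (by fun_prop)
    have hd : ∀ t ∈ Ioo (-s) s, HasDerivAt (fun t => -√(s ^ 2 + r ^ 2 - 2 * t * r) / r)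
        (√(s ^ 2 + r ^ 2 - 2 * t * r))⁻¹ t := fun t ht => by
      have h1 : HasDerivAt (fun t => s ^ 2 + r ^ 2 - 2 * t * r) (-(2 * 1 * r)) t :=
        (((hasDerivAt_id t).const_mul 2).mul_const r).const_sub _
      convert! ((h1.sqrt (hw t ht).ne').neg.div_const r) using 1
      have := Real.sqrt_pos.2 (hw t ht)
      field_simp
    -- When `r = s` the integrand is unbounded near `t = s`; integrability comes from its sign and a
    -- primitive continuous up to the endpoints.
    have hi := intervalIntegral.integrableOn_deriv_of_nonneg hc hd
      (fun t _ => inv_nonneg.2 (Real.sqrt_nonneg _))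
    refine ⟨hi.mono_set Ioo_subset_Ioc_self, ?_⟩
    have hle : -s ≤ s := by linarith
    rw [← integral_Ioc_eq_integral_Ioo, ← intervalIntegral.integral_of_le hle,
      intervalIntegral.integral_eq_sub_of_hasDerivAt_of_le hle hc hd
      ((intervalIntegrable_iff_integrableOn_Ioc_of_le hle).2 hi),
      show s ^ 2 + r ^ 2 - 2 * s * r = (s - r) ^ 2 by ring,
      show s ^ 2 + r ^ 2 - 2 * -s * r = (s + r) ^ 2 by ring, Real.sqrt_sq_eq_abs,
      Real.sqrt_sq (by positivity)]
    rcases le_total r s with h | h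
    · rw [max_eq_right h, abs_of_nonneg (by linarith)]
      field_simp; ring
    · rw [max_eq_left h, abs_of_nonpos (by linarith)]
      field_simp; ring

/-! ### Potentials of radial densities. -/

/-- The radial profile of the kernel with exponents `-1` and `q`. -/
def kernelProfile (q : ℕ) (ρ : ℝ) : ℝ := ρ ^ q / q + ρ⁻¹

lemma interactionKernel_eq (q : ℕ) (x : E3) :
    interactionKernel (-1) q x = kernelProfile q ‖x‖ := by
  simp [interactionKernel, kernelProfile, Real.rpow_neg_one, div_neg]

lemma kernelProfile_nonneg (q : ℕ) {ρ : ℝ} (h : 0 ≤ ρ) : 0 ≤ kernelProfile q ρ := by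
  unfold kernelProfile; positivity

lemma measurable_kernelProfile (q : ℕ) : Measurable (kernelProfile q) := by
  unfold kernelProfile; fun_prop

/-- The potential of a radial density, given the integral `J` over a sphere of the
attractive part of the kernel. -/
theorem integral_kernelProfile_mul {q : ℕ} {f J : ℝ → ℝ} (hf : Measurable f)
    (hf0 : ∀ s, 0 ≤ f s) (hJ : Measurable J) (x : E3)
    (heq : ∀ s, 0 < s → ∫ t in (-s)..s, √(s ^ 2 + ‖x‖ ^ 2 - 2 * t * ‖x‖) ^ q / q = J s) :
    ∫ y : E3, kernelProfile q ‖x - y‖ * f ‖y‖ =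
      2 * Real.pi * ∫ s in Ioi 0, s * f s * (J s + 2 * s / max ‖x‖ s) := by
  have hc : ∀ s : ℝ, Continuous fun t => √(s ^ 2 + ‖x‖ ^ 2 - 2 * t * ‖x‖) ^ q / (q : ℝ) :=
    fun s => by fun_prop
  have hi : ∀ s : ℝ, IntegrableOn (fun t => √(s ^ 2 + ‖x‖ ^ 2 - 2 * t * ‖x‖) ^ q / (q : ℝ))
      (Ioo (-s) s) := fun s =>
    ((hc s).integrableOn_Icc (a := -s) (b := s)).mono_set Ioo_subset_Icc_self
  refine integral_norm_mul_norm_sub hf (measurable_kernelProfile q) hf0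
    (fun s hs => kernelProfile_nonneg q hs) (by fun_prop) x (fun s hs => ?_) (fun s hs => ?_)
  · exact (hi s).add (integral_Ioo_sqrt_inv (norm_nonneg x) hs).1
  · have h := integral_Ioo_sqrt_inv (norm_nonneg x) hs
    have h2 := integral_add (hi s) h.1
    rw [← h.2, ← heq s hs, intervalIntegral.integral_of_le (by linarith),
      integral_Ioc_eq_integral_Ioo, ← h2]
    rfl

/-- The potential outside the support of a radial density. -/
lemma integral_profile_outside {f J : ℝ → ℝ} {R r : ℝ} (hR : 0 ≤ R) (hr : R ≤ r)
    (hf : ∀ s, R < s → f s = 0) :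
    ∫ s in Ioi 0, s * f s * (J s + 2 * s / max r s) =
      ∫ s in (0)..R, s * f s * (J s + 2 * s / r) := by
  rw [intervalIntegral.integral_of_le hR,
    setIntegral_eq_of_subset_of_forall_sdiff_eq_zero measurableSet_Ioi Ioc_subset_Ioi_self]
  · refine setIntegral_congr_fun measurableSet_Ioc fun s hs => ?_
    simp only [max_eq_left (hs.2.trans hr)]
  · rintro s ⟨h1, h2⟩
    have : R < s := by
      by_contra h
      exact h2 ⟨h1, not_lt.1 h⟩
    simp [hf s this]

/-- The potential inside the support of a radial density. -/
lemma integral_profile_inside {f J g : ℝ → ℝ} {R r : ℝ} (hr0 : 0 ≤ r) (hr : r ≤ R)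
    (hf : ∀ s, R < s → f s = 0) (hfg : ∀ s, s ≤ R → f s = g s) (hg : Continuous g)
    (hJ : Continuous J) :
    ∫ s in Ioi 0, s * f s * (J s + 2 * s / max r s) =
      (∫ s in (0)..r, s * g s * (J s + 2 * s / r)) + ∫ s in r..R, s * g s * (J s + 2) := by
  have hc1 : Continuous fun s => s * g s * (J s + 2 * s / r) := by fun_prop
  have hc2 : Continuous fun s => s * g s * (J s + 2) := by fun_prop
  have hu : Ioc 0 R = Ioc 0 r ∪ Ioc r R := (Ioc_union_Ioc_eq_Ioc hr0 hr).symm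
  have e1 : EqOn (fun s => s * f s * (J s + 2 * s / max r s))
      (fun s => s * g s * (J s + 2 * s / r)) (Ioc 0 r) := fun s hs => by
    simp only [max_eq_left hs.2, hfg s (hs.2.trans hr)]
  have e2 : EqOn (fun s => s * f s * (J s + 2 * s / max r s))
      (fun s => s * g s * (J s + 2)) (Ioc r R) := fun s hs => by
    have : 0 < s := hr0.trans_lt hs.1
    simp only [max_eq_right hs.1.le, hfg s hs.2, mul_div_cancel_right₀ _ this.ne']
  rw [intervalIntegral.integral_of_le hr0, intervalIntegral.integral_of_le hr,
    setIntegral_eq_of_subset_of_forall_sdiff_eq_zero (s := Ioc 0 R) measurableSet_Ioi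
      Ioc_subset_Ioi_self, hu, setIntegral_union (Ioc_disjoint_Ioc_of_le le_rfl)
      measurableSet_Ioc, setIntegral_congr_fun measurableSet_Ioc e1,
      setIntegral_congr_fun measurableSet_Ioc e2]
  · exact (hc1.integrableOn_Ioc).congr_fun e1.symm measurableSet_Ioc
  · exact (hc2.integrableOn_Ioc).congr_fun e2.symm measurableSet_Ioc
  · rintro s ⟨h1, h2⟩
    have : R < s := by
      by_contra h
      exact h2 ⟨h1, not_lt.1 h⟩
    simp [hf s this]

lemma integral_sqrt_sq_div (s r : ℝ) :
    ∫ t in (-s)..s, √(s ^ 2 + r ^ 2 - 2 * t * r) ^ 2 / (2 : ℕ) = s * (s ^ 2 + r ^ 2) := by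
  have h : ∀ t ∈ uIcc (-s) s, √(s ^ 2 + r ^ 2 - 2 * t * r) ^ 2 / ((2 : ℕ) : ℝ) =
      (s ^ 2 + r ^ 2) / 2 - r * t := fun t ht => by
    rw [Real.sq_sqrt]
    · push_cast; ring
    · have : t ^ 2 ≤ s ^ 2 := by
        rcases le_total (-s) s with h | h
        · rw [uIcc_of_le h] at ht; nlinarith [ht.1, ht.2]
        · rw [uIcc_of_ge h] at ht; nlinarith [ht.1, ht.2]
      nlinarith [sq_nonneg (t - r)]
  rw [intervalIntegral.integral_congr h, intervalIntegral.integral_sub (by simp)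
    (Continuous.intervalIntegrable (by fun_prop) _ _), intervalIntegral.integral_const_mul,
    integral_id, intervalIntegral.integral_const]
  simp only [smul_eq_mul]
  ring

lemma integral_sqrt_pow_four_div (s r : ℝ) :
    ∫ t in (-s)..s, √(s ^ 2 + r ^ 2 - 2 * t * r) ^ 4 / (4 : ℕ) =
      s * (s ^ 2 + r ^ 2) ^ 2 / 2 + 2 / 3 * r ^ 2 * s ^ 3 := by
  have h : ∀ t ∈ uIcc (-s) s, √(s ^ 2 + r ^ 2 - 2 * t * r) ^ 4 / ((4 : ℕ) : ℝ) =
      (s ^ 2 + r ^ 2) ^ 2 / 4 - ((s ^ 2 + r ^ 2) * r * t - r ^ 2 * t ^ 2) := fun t ht => by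
    rw [show (4 : ℕ) = 2 * 2 from rfl, pow_mul, Real.sq_sqrt]
    · push_cast; ring
    · have : t ^ 2 ≤ s ^ 2 := by
        rcases le_total (-s) s with h | h
        · rw [uIcc_of_le h] at ht; nlinarith [ht.1, ht.2]
        · rw [uIcc_of_ge h] at ht; nlinarith [ht.1, ht.2]
      nlinarith [sq_nonneg (t - r)]
  rw [intervalIntegral.integral_congr h, intervalIntegral.integral_sub (by simp)
    (Continuous.intervalIntegrable (by fun_prop) _ _), intervalIntegral.integral_sub
    (Continuous.intervalIntegrable (by fun_prop) _ _)
    (Continuous.intervalIntegrable (by fun_prop) _ _), intervalIntegral.integral_const_mul,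
    intervalIntegral.integral_const_mul, integral_id, integral_pow,
    intervalIntegral.integral_const]
  simp only [smul_eq_mul]
  norm_num
  ring

/-! ### Bilinear energies and the sign of the attractive part. -/

/-- Bounded functions with a finite moment of order `q`. -/
structure IsTame (q : ℕ) (f : E3 → ℝ) : Prop where
  integrable : Integrable f
  moment : Integrable fun x => ‖x‖ ^ q * |f x|
  bound : ∃ C, 0 ≤ C ∧ ∀ᵐ x, |f x| ≤ C

lemma IsTame.sub {q : ℕ} {f g : E3 → ℝ} (hf : IsTame q f) (hg : IsTame q g) :
    IsTame q fun x => f x - g x := by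
  refine ⟨hf.integrable.sub hg.integrable, ?_, ?_⟩
  · refine (hf.moment.add hg.moment).mono' ?_ (Filter.Eventually.of_forall fun x => ?_)
    · exact ((continuous_norm.pow q).aestronglyMeasurable).mul
        (hf.integrable.sub hg.integrable).aestronglyMeasurable.norm
    · rw [Real.norm_of_nonneg (by positivity), Pi.add_apply, ← mul_add]
      exact mul_le_mul_of_nonneg_left (abs_sub _ _) (by positivity)
  · obtain ⟨C, hC0, hC⟩ := hf.bound
    obtain ⟨D, hD0, hD⟩ := hg.bound
    refine ⟨C + D, add_nonneg hC0 hD0, ?_⟩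
    filter_upwards [hC, hD] with x h1 h2
    exact (abs_sub _ _).trans (add_le_add h1 h2)

lemma IsTame.integrable_mul {q : ℕ} {f : E3 → ℝ} (hf : IsTame q f) {p : E3 → ℝ}
    (hp : Continuous p) {C : ℝ} (hC : ∀ x, |p x| ≤ C * (1 + ‖x‖ ^ q)) :
    Integrable fun x => p x * f x := by
  refine ((hf.integrable.abs.add hf.moment).const_mul C).mono'
    (hp.aestronglyMeasurable.mul hf.integrable.aestronglyMeasurable)
    (Filter.Eventually.of_forall fun x => ?_)
  rw [norm_mul, Real.norm_eq_abs, Real.norm_eq_abs, Pi.add_apply]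
  calc |p x| * |f x| ≤ C * (1 + ‖x‖ ^ q) * |f x| :=
        mul_le_mul_of_nonneg_right (hC x) (abs_nonneg _)
    _ = C * (|f x| + ‖x‖ ^ q * |f x|) := by ring

lemma norm_pow_le_one_add {k q : ℕ} (h : k ≤ q) (x : E3) : ‖x‖ ^ k ≤ 1 + ‖x‖ ^ q := by
  rcases le_total ‖x‖ 1 with h1 | h1
  · have := pow_le_one₀ (n := k) (norm_nonneg x) h1
    have : 0 ≤ ‖x‖ ^ q := by positivity
    linarith
  · have := pow_le_pow_right₀ h1 h
    linarith

lemma IsTame.integrable_mul_of_le {q k : ℕ} {f : E3 → ℝ} (hf : IsTame q f) {p : E3 → ℝ}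
    (hp : Continuous p) (hk : k ≤ q) (h : ∀ x, |p x| ≤ ‖x‖ ^ k) :
    Integrable fun x => p x * f x :=
  hf.integrable_mul hp (C := 1) fun x => by
    rw [one_mul]; exact (h x).trans (norm_pow_le_one_add hk x)

/-- The kernel `F` has a finite energy against `f` and `g`, with value `v`. -/
def HasEnergy (F : E3 → E3 → ℝ) (f g : E3 → ℝ) (v : ℝ) : Prop :=
  Integrable (fun z : E3 × E3 => F z.1 z.2 * f z.1 * g z.2) ∧
    ∫ z : E3 × E3, F z.1 z.2 * f z.1 * g z.2 = v

lemma HasEnergy.add {F G : E3 → E3 → ℝ} {f g : E3 → ℝ} {v w : ℝ} (hF : HasEnergy F f g v)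
    (hG : HasEnergy G f g w) : HasEnergy (fun x y => F x y + G x y) f g (v + w) := by
  have h : (fun z : E3 × E3 => (F z.1 z.2 + G z.1 z.2) * f z.1 * g z.2) = fun z =>
      F z.1 z.2 * f z.1 * g z.2 + G z.1 z.2 * f z.1 * g z.2 := by ext z; ring
  refine ⟨?_, ?_⟩
  · rw [h]; exact hF.1.add hG.1
  · rw [h, integral_add hF.1 hG.1, hF.2, hG.2]

lemma HasEnergy.const_mul {F : E3 → E3 → ℝ} {f g : E3 → ℝ} {v : ℝ} (hF : HasEnergy F f g v)
    (c : ℝ) : HasEnergy (fun x y => c * F x y) f g (c * v) := by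
  have h : (fun z : E3 × E3 => (c * F z.1 z.2) * f z.1 * g z.2) = fun z =>
      c * (F z.1 z.2 * f z.1 * g z.2) := by ext z; ring
  refine ⟨?_, ?_⟩
  · rw [h]; exact hF.1.const_mul c
  · rw [h, integral_const_mul, hF.2]

lemma HasEnergy.sum {ι : Type} (s : Finset ι) {F : ι → E3 → E3 → ℝ} {f g : E3 → ℝ} {v : ι → ℝ}
    (hF : ∀ i ∈ s, HasEnergy (F i) f g (v i)) :
    HasEnergy (fun x y => ∑ i ∈ s, F i x y) f g (∑ i ∈ s, v i) := by
  have h : (fun z : E3 × E3 => (∑ i ∈ s, F i z.1 z.2) * f z.1 * g z.2) = fun z =>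
      ∑ i ∈ s, F i z.1 z.2 * f z.1 * g z.2 := by
    ext z; rw [Finset.sum_mul, Finset.sum_mul]
  refine ⟨?_, ?_⟩
  · rw [h]; exact integrable_finsetSum s fun i hi => (hF i hi).1
  · rw [h, integral_finsetSum s fun i hi => (hF i hi).1]
    exact Finset.sum_congr rfl fun i hi => (hF i hi).2

lemma hasEnergy_mul {a b f g : E3 → ℝ} (ha : Integrable fun x => a x * f x)
    (hb : Integrable fun x => b x * g x) :
    HasEnergy (fun x y => a x * b y) f g ((∫ x, a x * f x) * ∫ x, b x * g x) := by
  have h : (fun z : E3 × E3 => a z.1 * b z.2 * f z.1 * g z.2) = fun z =>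
      (a z.1 * f z.1) * (b z.2 * g z.2) := by ext z; ring
  refine ⟨?_, ?_⟩
  · rw [h, Measure.volume_eq_prod]; exact Integrable.mul_prod ha hb
  · rw [h, Measure.volume_eq_prod]
    exact integral_prod_mul (fun x => a x * f x) (fun x => b x * g x)

lemma norm_sq_eq_sum (x : E3) : ‖x‖ ^ 2 = x 0 ^ 2 + x 1 ^ 2 + x 2 ^ 2 := by
  simp [EuclideanSpace.norm_sq_eq, Fin.sum_univ_three]

lemma abs_apply_le_norm (x : E3) (i : Fin 3) : |x i| ≤ ‖x‖ := PiLp.norm_apply_le x i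

/-- The quadratic kernel annihilates functions without mass and first moments. -/
lemma hasEnergy_norm_sq {q : ℕ} (hq : 2 ≤ q) {h : E3 → ℝ} (hh : IsTame q h)
    (h0 : ∫ x, h x = 0) (h1 : ∀ i, ∫ x, x i * h x = 0) :
    HasEnergy (fun x y => ‖x - y‖ ^ 2) h h 0 := by
  have i1 : Integrable fun x => (1 : ℝ) * h x := by simpa using hh.integrable
  have i2 : Integrable fun x => ‖x‖ ^ 2 * h x :=
    hh.integrable_mul_of_le (by fun_prop) hq fun x => by rw [abs_of_nonneg (by positivity)]
  have ic : ∀ i : Fin 3, Integrable fun x : E3 => x i * h x := fun i =>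
    hh.integrable_mul_of_le (k := 1) (by fun_prop) (by omega) fun x => by
      rw [pow_one]; exact abs_apply_le_norm x i
  -- `‖x - y‖² = ‖x‖² + ‖y‖² - 2 x·y`: each term has a factor that integrates to zero against `h`.
  have := ((hasEnergy_mul i2 i1).add (hasEnergy_mul i1 i2)).add
    ((HasEnergy.sum Finset.univ fun i _ => hasEnergy_mul (ic i) (ic i)).const_mul (-2))
  convert! this using 1
  · ext x y
    simp only [norm_sq_eq_sum, Fin.sum_univ_three, PiLp.sub_apply]
    ring
  · simp [h0, h1]

/-- The quartic kernel is nonnegative on functions without mass and first moments. -/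
lemma hasEnergy_norm_pow_four {q : ℕ} (hq : 4 ≤ q) {h : E3 → ℝ} (hh : IsTame q h)
    (h0 : ∫ x, h x = 0) (h1 : ∀ i, ∫ x, x i * h x = 0) :
    ∃ v, 0 ≤ v ∧ HasEnergy (fun x y => ‖x - y‖ ^ 4) h h v := by
  have i1 : Integrable fun x => (1 : ℝ) * h x := by simpa using hh.integrable
  have i2 : Integrable fun x => ‖x‖ ^ 2 * h x :=
    hh.integrable_mul_of_le (k := 2) (by fun_prop) (by omega) fun x => by
      rw [abs_of_nonneg (by positivity)]
  have i4 : Integrable fun x => ‖x‖ ^ 4 * h x :=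
    hh.integrable_mul_of_le (k := 4) (by fun_prop) (by omega) fun x => by
      rw [abs_of_nonneg (by positivity)]
  have ic : ∀ i : Fin 3, Integrable fun x : E3 => x i * h x := fun i =>
    hh.integrable_mul_of_le (k := 1) (by fun_prop) (by omega) fun x => by
      rw [pow_one]; exact abs_apply_le_norm x i
  have icc : ∀ p : Fin 3 × Fin 3, Integrable fun x : E3 => (x p.1 * x p.2) * h x := fun p =>
    hh.integrable_mul_of_le (k := 2) (by fun_prop) (by omega) fun x => by
      rw [abs_mul, sq]
      exact mul_le_mul (abs_apply_le_norm x _) (abs_apply_le_norm x _) (abs_nonneg _)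
        (norm_nonneg _)
  have ict : ∀ i : Fin 3, Integrable fun x : E3 => (x i * ‖x‖ ^ 2) * h x := fun i =>
    hh.integrable_mul_of_le (k := 3) (by fun_prop) (by omega) fun x => by
      rw [abs_mul, abs_of_nonneg (by positivity : 0 ≤ ‖x‖ ^ 2), pow_succ' _ 2]
      exact mul_le_mul_of_nonneg_right (abs_apply_le_norm x i) (by positivity)
  -- `‖x - y‖⁴ = ‖x‖⁴ + ‖y‖⁴ + 2‖x‖²‖y‖² + 4(x·y)² - 4(x·y)(‖x‖² + ‖y‖²)`. Only the third and fourth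
  -- terms survive, and they give squares of second moments.
  have := (((((hasEnergy_mul i4 i1).add (hasEnergy_mul i1 i4)).add
    ((hasEnergy_mul i2 i2).const_mul 2)).add
    ((HasEnergy.sum Finset.univ fun p _ => hasEnergy_mul (icc p) (icc p)).const_mul 4)).add
    ((HasEnergy.sum Finset.univ fun i _ => hasEnergy_mul (ic i) (ict i)).const_mul (-4))).add
    ((HasEnergy.sum Finset.univ fun i _ => hasEnergy_mul (ict i) (ic i)).const_mul (-4))
  refine ⟨2 * ((∫ x, ‖x‖ ^ 2 * h x) * ∫ x, ‖x‖ ^ 2 * h x) + 4 * ∑ p : Fin 3 × Fin 3,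
    (∫ x, (x p.1 * x p.2) * h x) * ∫ x, (x p.1 * x p.2) * h x, ?_, ?_⟩
  · have := Finset.sum_nonneg (s := Finset.univ) fun (p : Fin 3 × Fin 3) _ =>
      mul_self_nonneg (∫ x : E3, (x p.1 * x p.2) * h x)
    nlinarith [mul_self_nonneg (∫ x, ‖x‖ ^ 2 * h x)]
  · convert! this using 1
    · ext x y
      rw [show ‖x - y‖ ^ 4 = (‖x - y‖ ^ 2) ^ 2 by ring, show ‖x‖ ^ 4 = (‖x‖ ^ 2) ^ 2 by ring,
        show ‖y‖ ^ 4 = (‖y‖ ^ 2) ^ 2 by ring]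
      simp only [norm_sq_eq_sum, Fintype.sum_prod_type, Fin.sum_univ_three, PiLp.sub_apply]
      ring
    · simp [h0, h1]

/-- The kernel is split at distance one: nearby `g` is replaced by its bound and `ρ⁻¹ ρ²` is
integrable at zero, while far away the kernel is at most one. Translation invariance makes the bound
uniform in `x`. -/
lemma exists_integral_inv_norm_sub_bound {q : ℕ} {g : E3 → ℝ} (hg : IsTame q g) :
    ∃ D, ∀ x : E3, Integrable (fun y => ‖x - y‖⁻¹ * g y) ∧
      ∫ y, ‖‖x - y‖⁻¹ * g y‖ ≤ D := by
  obtain ⟨C, hC0, hC⟩ := hg.bound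
  set φ : E3 → ℝ := fun z => (Iio (1 : ℝ)).indicator (fun ρ => ρ⁻¹) ‖z‖ with hφ
  have hφi : Integrable φ := by
    refine (integrable_fun_norm_addHaar volume (f := (Iio (1 : ℝ)).indicator fun ρ => ρ⁻¹)).2 ?_
    rw [finrank_euclideanSpace_fin]
    have h1 : IntegrableOn ((Ioo (0 : ℝ) 1).indicator fun y => y) (Ioi 0) :=
      ((integrable_indicator_iff measurableSet_Ioo).2
        (continuous_id.integrableOn_Icc.mono_set Ioo_subset_Icc_self)).integrableOn
    refine h1.congr_fun (fun y hy => ?_) measurableSet_Ioi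
    have hy : 0 < y := hy
    by_cases h : y < 1
    · simp [h, hy]
      field_simp
    · simp [h]
  have hbd : ∀ x : E3, ∀ᵐ y, ‖‖x - y‖⁻¹ * g y‖ ≤ C * φ (x - y) + |g y| := by
    intro x
    filter_upwards [hC] with y hy
    rw [norm_mul, norm_inv, norm_norm, Real.norm_eq_abs, hφ]
    have h0 := abs_nonneg (g y)
    by_cases h : ‖x - y‖ < 1
    · simp only [indicator_of_mem (mem_Iio.2 h)]
      have : ‖x - y‖⁻¹ * |g y| ≤ ‖x - y‖⁻¹ * C :=
        mul_le_mul_of_nonneg_left hy (by positivity)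
      linarith
    · simp only [indicator_of_notMem (show ‖x - y‖ ∉ Iio (1 : ℝ) from h)]
      have : ‖x - y‖⁻¹ * |g y| ≤ 1 * |g y| :=
        mul_le_mul_of_nonneg_right (inv_le_one_of_one_le₀ (not_lt.1 h)) h0
      linarith
  have hi : ∀ x : E3, Integrable fun y => C * φ (x - y) + |g y| := fun x =>
    ((hφi.comp_sub_left x).const_mul C).add hg.integrable.abs
  refine ⟨C * (∫ z, φ z) + ∫ y, |g y|, fun x => ?_⟩
  have hx : Integrable fun y => ‖x - y‖⁻¹ * g y :=
    (hi x).mono' ((by fun_prop : Measurable fun y : E3 => ‖x - y‖⁻¹).aestronglyMeasurable.mul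
      hg.integrable.aestronglyMeasurable) (hbd x)
  refine ⟨hx, (integral_mono_ae hx.norm (hi x) (hbd x)).trans (le_of_eq ?_)⟩
  rw [integral_add ((hφi.comp_sub_left x).const_mul C) hg.integrable.abs, integral_const_mul,
    integral_sub_left_eq_self φ volume x]

lemma integrable_coulomb {q : ℕ} {f g : E3 → ℝ} (hf : IsTame q f) (hg : IsTame q g) :
    Integrable fun z : E3 × E3 => ‖z.1 - z.2‖⁻¹ * f z.1 * g z.2 := by
  obtain ⟨D, hD⟩ := exists_integral_inv_norm_sub_bound hg
  have hm : AEStronglyMeasurable (fun z : E3 × E3 => ‖z.1 - z.2‖⁻¹ * f z.1 * g z.2)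
      (volume.prod volume) :=
    ((by fun_prop : Measurable fun z : E3 × E3 => ‖z.1 - z.2‖⁻¹).aestronglyMeasurable.mul
      hf.integrable.aestronglyMeasurable.comp_fst).mul
      hg.integrable.aestronglyMeasurable.comp_snd
  rw [Measure.volume_eq_prod]
  refine (integrable_prod_iff hm).2 ⟨Filter.Eventually.of_forall fun x => ?_, ?_⟩
  · refine ((hD x).1.const_mul (f x)).congr (Filter.Eventually.of_forall fun y => ?_)
    simp only
    ring
  · refine (hf.integrable.abs.const_mul D).mono' hm.norm.integral_prod_right'
      (Filter.Eventually.of_forall fun x => ?_)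
    have : ∀ y, ‖‖x - y‖⁻¹ * f x * g y‖ = |f x| * ‖‖x - y‖⁻¹ * g y‖ := fun y => by
      rw [← Real.norm_eq_abs, ← norm_mul]; congr 1; ring
    simp only [this]
    rw [integral_const_mul, Real.norm_of_nonneg
      (mul_nonneg (abs_nonneg _) (integral_nonneg fun y => norm_nonneg _)), mul_comm D]
    exact mul_le_mul_of_nonneg_left (hD x).2 (abs_nonneg _)

lemma integrable_norm_sub_pow {q : ℕ} {f g : E3 → ℝ} (hf : IsTame q f) (hg : IsTame q g) :
    Integrable fun z : E3 × E3 => ‖z.1 - z.2‖ ^ q * f z.1 * g z.2 := by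
  have hm : AEStronglyMeasurable (fun z : E3 × E3 => ‖z.1 - z.2‖ ^ q * f z.1 * g z.2)
      (volume.prod volume) :=
    ((by fun_prop : Measurable fun z : E3 × E3 => ‖z.1 - z.2‖ ^ q).aestronglyMeasurable.mul
      hf.integrable.aestronglyMeasurable.comp_fst).mul
      hg.integrable.aestronglyMeasurable.comp_snd
  rw [Measure.volume_eq_prod]
  have h1 := Integrable.mul_prod hf.moment hg.integrable.abs
  have h2 := Integrable.mul_prod hf.integrable.abs hg.moment
  refine ((h1.add h2).const_mul (2 ^ (q - 1))).mono' hm (Filter.Eventually.of_forall fun z => ?_)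
  rw [norm_mul, norm_mul, Real.norm_of_nonneg (by positivity), Real.norm_eq_abs,
    Real.norm_eq_abs, Pi.add_apply]
  have h3 : ‖z.1 - z.2‖ ^ q ≤ 2 ^ (q - 1) * (‖z.1‖ ^ q + ‖z.2‖ ^ q) :=
    (pow_le_pow_left₀ (norm_nonneg _) (norm_sub_le _ _) q).trans
      (add_pow_le (norm_nonneg _) (norm_nonneg _) q)
  calc ‖z.1 - z.2‖ ^ q * |f z.1| * |g z.2|
      ≤ 2 ^ (q - 1) * (‖z.1‖ ^ q + ‖z.2‖ ^ q) * |f z.1| * |g z.2| := by gcongr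
    _ = _ := by ring

lemma hasEnergy_coulomb {q : ℕ} {f g : E3 → ℝ} (hf : IsTame q f) (hg : IsTame q g) :
    HasEnergy (fun x y => ‖x - y‖⁻¹) f g
      (∫ z : E3 × E3, ‖z.1 - z.2‖⁻¹ * f z.1 * g z.2) :=
  ⟨integrable_coulomb hf hg, rfl⟩

lemma integrable_kernelProfile {q : ℕ} {f g : E3 → ℝ} (hf : IsTame q f) (hg : IsTame q g) :
    Integrable fun z : E3 × E3 => kernelProfile q ‖z.1 - z.2‖ * f z.1 * g z.2 := by
  have h : HasEnergy (fun x y => ‖x - y‖ ^ q) f g _ := ⟨integrable_norm_sub_pow hf hg, rfl⟩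
  have := (h.const_mul (q : ℝ)⁻¹).add (hasEnergy_coulomb hf hg)
  refine this.1.congr (Filter.Eventually.of_forall fun z => ?_)
  simp only [kernelProfile]
  ring

/-- The energy of a function without mass and first moments dominates its Coulomb energy. -/
lemma coulomb_le_energy {q : ℕ} (hq : q = 2 ∨ q = 4) {h : E3 → ℝ} (hh : IsTame q h)
    (h0 : ∫ x, h x = 0) (h1 : ∀ i, ∫ x, x i * h x = 0) :
    ∫ z : E3 × E3, ‖z.1 - z.2‖⁻¹ * h z.1 * h z.2 ≤
      ∫ z : E3 × E3, kernelProfile q ‖z.1 - z.2‖ * h z.1 * h z.2 := by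
  obtain ⟨v, hv, hE⟩ : ∃ v, 0 ≤ v ∧ HasEnergy (fun x y => ‖x - y‖ ^ q) h h v := by
    rcases hq with rfl | rfl
    · exact ⟨0, le_rfl, hasEnergy_norm_sq le_rfl hh h0 h1⟩
    · exact hasEnergy_norm_pow_four le_rfl hh h0 h1
  have := ((hE.const_mul (q : ℝ)⁻¹).add (hasEnergy_coulomb hh hh)).2
  have e : ∫ z : E3 × E3, kernelProfile q ‖z.1 - z.2‖ * h z.1 * h z.2 =
      (q : ℝ)⁻¹ * v + ∫ z : E3 × E3, ‖z.1 - z.2‖⁻¹ * h z.1 * h z.2 := by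
    rw [← this]
    refine integral_congr_ae (Filter.Eventually.of_forall fun z => ?_)
    simp only [kernelProfile]
    ring
  rw [e]
  have : 0 ≤ (q : ℝ)⁻¹ * v := by positivity
  linarith

/-! ### Admissible functions, centring, and the sufficient condition for minimality. -/

lemma interactionEnergy_eq (q : ℕ) (u : E3 → ℝ) :
    interactionEnergy (-1) q u =
      ∫ z : E3 × E3, kernelProfile q ‖z.1 - z.2‖ * u z.1 * u z.2 := by
  simp only [interactionEnergy, interactionKernel_eq]

lemma memMomentSpace_iff {q : ℕ} {f : E3 → ℝ} :
    MemMomentSpace q f ↔ Integrable f ∧ Integrable fun x => ‖x‖ ^ q * |f x| := by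
  simp only [MemMomentSpace, Real.rpow_natCast]
  refine and_congr_right fun hf => ⟨fun h => ?_, fun h => ?_⟩
  · refine (h.sub hf.abs).congr (Filter.Eventually.of_forall fun x => ?_)
    simp only [Pi.sub_apply]
    ring
  · refine (h.add hf.abs).congr (Filter.Eventually.of_forall fun x => ?_)
    simp only [Pi.add_apply]
    ring

lemma IsAdmissible.isTame {q : ℕ} {m M : ℝ} (hM : 0 < M) {u : E3 → ℝ}
    (hu : IsAdmissible q m M u) : IsTame q u :=
  ⟨(memMomentSpace_iff.1 hu.memMomentSpace).1, (memMomentSpace_iff.1 hu.memMomentSpace).2,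
    M, hM.le, hu.le_bound⟩

lemma ae_comp_add_right {p : E3 → Prop} (h : ∀ᵐ x, p x) (c : E3) : ∀ᵐ x, p (x + c) :=
  (measurePreserving_add_right volume c).quasiMeasurePreserving.ae h

lemma IsAdmissible.comp_add_right {q : ℕ} {m M : ℝ} (hM : 0 < M) {u : E3 → ℝ}
    (hu : IsAdmissible q m M u) (c : E3) : IsAdmissible q m M fun x => u (x + c) := by
  have ht := hu.isTame hM
  refine ⟨memMomentSpace_iff.2 ⟨ht.integrable.comp_add_right c, ?_⟩,
    ae_comp_add_right hu.nonneg c, ae_comp_add_right hu.le_bound c, ?_⟩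
  · have h1 : Integrable fun x => ‖x - c‖ ^ q * |u x| := by
      refine ((ht.moment.add (ht.integrable.abs.const_mul (‖c‖ ^ q))).const_mul
        (2 ^ (q - 1))).mono' ?_ (Filter.Eventually.of_forall fun x => ?_)
      · exact (by fun_prop : Continuous fun x : E3 => ‖x - c‖ ^ q).aestronglyMeasurable.mul
          ht.integrable.aestronglyMeasurable.norm
      · rw [Real.norm_of_nonneg (by positivity), Pi.add_apply, ← add_mul, ← mul_assoc]
        exact mul_le_mul_of_nonneg_right ((pow_le_pow_left₀ (norm_nonneg _) (norm_sub_le _ _)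
          q).trans (add_pow_le (norm_nonneg _) (norm_nonneg _) q)) (abs_nonneg _)
    simpa using h1.comp_add_right c
  · rw [integral_add_right_eq_self]; exact hu.integral_eq

lemma interactionEnergy_comp_add_right (q : ℕ) (u : E3 → ℝ) (c : E3) :
    interactionEnergy (-1) q (fun x => u (x + c)) = interactionEnergy (-1) q u := by
  rw [interactionEnergy_eq, interactionEnergy_eq]
  have : (volume : Measure (E3 × E3)).IsAddRightInvariant := by
    rw [Measure.volume_eq_prod]; infer_instance
  rw [← integral_add_right_eq_self (μ := (volume : Measure (E3 × E3)))
    (fun z => kernelProfile q ‖z.1 - z.2‖ * u z.1 * u z.2) (c, c)]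
  simp

/-- Every admissible function has a translate centred at the origin. -/
lemma IsAdmissible.exists_centered {q : ℕ} (hq : 1 ≤ q) {m M : ℝ} (hm : 0 < m) (hM : 0 < M)
    {u : E3 → ℝ} (hu : IsAdmissible q m M u) :
    ∃ c : E3, ∀ i, ∫ x : E3, x i * u (x + c) = 0 := by
  have ht := hu.isTame hM
  refine ⟨WithLp.toLp 2 fun i => m⁻¹ * ∫ x : E3, x i * u x, fun i => ?_⟩
  set c : E3 := WithLp.toLp 2 fun i => m⁻¹ * ∫ x : E3, x i * u x with hc
  have h1 : ∀ x : E3, x i * u (x + c) = (fun y : E3 => y i * u y - c i * u y) (x + c) := by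
    intro x; simp only [PiLp.add_apply]; ring
  have hi : Integrable fun x : E3 => x i * u x :=
    ht.integrable_mul_of_le (k := 1) (by fun_prop) hq fun x => by
      rw [pow_one]; exact abs_apply_le_norm x i
  simp only [h1]
  rw [integral_add_right_eq_self (fun y : E3 => y i * u y - c i * u y),
    integral_sub hi (ht.integrable.const_mul _), integral_const_mul, hu.integral_eq]
  simp only [hc]
  field_simp
  ring

/-- The energy gap above a centred admissible function satisfying the variational inequality. -/
lemma energy_add_coulomb_le {q : ℕ} (hq : q = 2 ∨ q = 4) {m M : ℝ} (hM : 0 < M)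
    {u v : E3 → ℝ} (hu : IsAdmissible q m M u) (hv : IsAdmissible q m M v)
    (hu1 : ∀ i, ∫ x : E3, x i * u x = 0) (hv1 : ∀ i, ∫ x : E3, x i * v x = 0) {c : ℝ}
    (hV : ∀ᵐ x : E3, 0 ≤ ((∫ y, kernelProfile q ‖x - y‖ * u y) - c) * (v x - u x)) :
    interactionEnergy (-1) q u +
        ∫ z : E3 × E3, ‖z.1 - z.2‖⁻¹ * (v z.1 - u z.1) * (v z.2 - u z.2) ≤
      interactionEnergy (-1) q v := by
  have hut := hu.isTame hM
  have hvt := hv.isTame hM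
  have hht := hvt.sub hut
  set h : E3 → ℝ := fun x => v x - u x with hh
  have h0 : ∫ x, h x = 0 := by
    rw [hh, integral_sub hvt.integrable hut.integrable, hu.integral_eq, hv.integral_eq, sub_self]
  have hq1 : 1 ≤ q := by omega
  have h1 : ∀ i, ∫ x, x i * h x = 0 := fun i => by
    have hi : ∀ {f : E3 → ℝ}, IsTame q f → Integrable fun x : E3 => x i * f x := fun ht =>
      ht.integrable_mul_of_le (k := 1) (by fun_prop) hq1 fun x => by
        rw [pow_one]; exact abs_apply_le_norm x i
    simp only [hh, mul_sub]
    rw [integral_sub (hi hvt) (hi hut), hu1, hv1, sub_self]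
  have k1 := integrable_kernelProfile hut hut
  have k2 := integrable_kernelProfile hht hut
  have k3 := integrable_kernelProfile hut hht
  have k4 := integrable_kernelProfile hht hht
  -- Expansion of the quadratic form at `u`; the two cross terms agree by the symmetry of the
  -- kernel.
  have e : interactionEnergy (-1) q v = interactionEnergy (-1) q u +
      2 * (∫ z : E3 × E3, kernelProfile q ‖z.1 - z.2‖ * h z.1 * u z.2) +
      ∫ z : E3 × E3, kernelProfile q ‖z.1 - z.2‖ * h z.1 * h z.2 := by
    have e1 : (∫ z : E3 × E3, kernelProfile q ‖z.1 - z.2‖ * u z.1 * h z.2) =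
        ∫ z : E3 × E3, kernelProfile q ‖z.1 - z.2‖ * h z.1 * u z.2 := by
      rw [Measure.volume_eq_prod, ← integral_prod_swap]
      refine integral_congr_ae (Filter.Eventually.of_forall fun z => ?_)
      simp only [Prod.fst_swap, Prod.snd_swap, norm_sub_rev z.2]
      ring
    rw [interactionEnergy_eq, interactionEnergy_eq, two_mul]
    nth_rewrite 1 [← e1]
    have k13 : Integrable fun z : E3 × E3 => kernelProfile q ‖z.1 - z.2‖ * u z.1 * u z.2 +
      kernelProfile q ‖z.1 - z.2‖ * u z.1 * h z.2 := k1.add k3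
    have k132 : Integrable fun z : E3 × E3 => kernelProfile q ‖z.1 - z.2‖ * u z.1 * u z.2 +
      kernelProfile q ‖z.1 - z.2‖ * u z.1 * h z.2 +
      kernelProfile q ‖z.1 - z.2‖ * h z.1 * u z.2 := k13.add k2
    rw [← add_assoc, ← integral_add k1 k3, ← integral_add k13 k2, ← integral_add k132 k4]
    refine integral_congr_ae (Filter.Eventually.of_forall fun z => ?_)
    simp only [hh]
    ring
  have hpos : 0 ≤ ∫ z : E3 × E3, kernelProfile q ‖z.1 - z.2‖ * h z.1 * u z.2 := by
    have hs : ∀ x : E3, ∫ y, kernelProfile q ‖x - y‖ * h x * u y =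
        (∫ y, kernelProfile q ‖x - y‖ * u y) * h x := fun x => by
      rw [← integral_mul_const]
      refine integral_congr_ae (Filter.Eventually.of_forall fun y => ?_)
      simp only
      ring
    rw [Measure.volume_eq_prod] at k2
    have k5 := k2.integral_prod_left
    rw [Measure.volume_eq_prod, integral_prod _ k2]
    simp only [hs] at k5 ⊢
    -- Since `h` has no mass, the potential matters only up to an additive constant, which serves as
    -- the Lagrange multiplier of the mass constraint.
    have e2 : ∫ x, (∫ y, kernelProfile q ‖x - y‖ * u y) * h x =
        ∫ x, ((∫ y, kernelProfile q ‖x - y‖ * u y) - c) * h x := by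
      simp only [sub_mul]
      rw [integral_sub k5 (hht.integrable.const_mul c), integral_const_mul, h0, mul_zero, sub_zero]
    rw [e2]
    exact integral_nonneg_of_ae hV
  have := coulomb_le_energy hq hht h0 h1
  rw [e]
  linarith

/-- A centred admissible function satisfying the variational inequality is the minimizer. -/
theorem isTheMinimizer_of_potential {q : ℕ} (hq : q = 2 ∨ q = 4) {m M : ℝ} (hm : 0 < m)
    (hM : 0 < M) {u : E3 → ℝ} (hu : IsAdmissible q m M u)
    (hu1 : ∀ i, ∫ x : E3, x i * u x = 0) (c : ℝ)
    (hV : ∀ v, IsAdmissible q m M v →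
      ∀ᵐ x : E3, 0 ≤ ((∫ y, kernelProfile q ‖x - y‖ * u y) - c) * (v x - u x)) :
    IsTheMinimizer (-1) q m M u := by
  have hcoul : ∀ v, IsAdmissible q m M v →
      0 ≤ ∫ z : E3 × E3, ‖z.1 - z.2‖⁻¹ * (v z.1 - u z.1) * (v z.2 - u z.2) := fun v hv => by
    have ht := (hv.isTame hM).sub (hu.isTame hM)
    exact coulomb_nonneg ht.integrable.aestronglyMeasurable (integrable_coulomb ht ht)
  have hmin : IsMinimizer (-1) q m M u := by
    refine ⟨hu, fun v hv => ?_⟩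
    obtain ⟨a, ha⟩ := hv.exists_centered (by omega) hm hM
    have hva := hv.comp_add_right hM a
    have := energy_add_coulomb_le hq hM hu hva hu1 ha (hV _ hva)
    rw [interactionEnergy_comp_add_right q v a] at this
    have := hcoul _ hva
    linarith
  refine ⟨hmin, fun v hv => ?_⟩
  obtain ⟨a, ha⟩ := hv.1.exists_centered (by omega) hm hM
  have hva := hv.1.comp_add_right hM a
  have h1 := energy_add_coulomb_le hq hM hu hva hu1 ha (hV _ hva)
  rw [interactionEnergy_comp_add_right q v a] at h1
  have ht := (hva.isTame hM).sub (hu.isTame hM)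
  -- Equal energies squeeze the Coulomb energy of the difference to zero, so the centred translate
  -- of `v` equals `u`.
  have h2 := ae_eq_zero_of_coulomb_eq_zero ht.integrable (integrable_coulomb ht ht)
    (le_antisymm (by linarith [hv.2 u hu]) (hcoul _ hva))
  refine ⟨a, ?_⟩
  filter_upwards [ae_comp_add_right h2 (-a)] with x hx
  have : v (x + -a + a) - u (x + -a) = 0 := hx
  rw [neg_add_cancel_right, sub_eq_zero, ← sub_eq_add_neg] at this
  exact this

/-! ### Radial densities and the potential of a truncated quadratic profile. -/

lemma integral_radialFunction {f : ℝ → ℝ} (hf : Measurable f) (hf0 : ∀ s, 0 ≤ f s) :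
    ∫ x, radialFunction 3 f x = 2 * Real.pi * ∫ s in Ioi 0, s * f s * (2 * s) := by
  have := integral_norm_mul_norm_sub (k := fun _ => 1) (I := fun s => 2 * s) hf
    measurable_const hf0 (fun _ _ => zero_le_one) (by fun_prop) 0 (fun s _ => by simp)
    (fun s hs => by
      rw [setIntegral_const, Real.volume_real_Ioo_of_le (by linarith)]
      simp only [smul_eq_mul]
      ring)
  rw [← this]
  simp [radialFunction]

lemma integral_radialFunction_coord (f : ℝ → ℝ) (i : Fin 3) :
    ∫ x : E3, x i * radialFunction 3 f x = 0 := by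
  have h := integral_neg_eq_self (fun x : E3 => x i * radialFunction 3 f x) volume
  have h2 : ∫ x : E3, (-x) i * radialFunction 3 f (-x) =
      -∫ x : E3, x i * radialFunction 3 f x := by
    rw [← integral_neg]
    refine integral_congr_ae (Filter.Eventually.of_forall fun x => ?_)
    simp [radialFunction]
  linarith

lemma isAdmissible_radialFunction {q : ℕ} {m M R : ℝ} {f : ℝ → ℝ} (hf : Measurable f)
    (hf0 : ∀ s, 0 ≤ f s) (hfM : ∀ s, 0 ≤ s → f s ≤ M) (hfR : ∀ s, R < s → f s = 0)
    (hm : 2 * Real.pi * ∫ s in Ioi 0, s * f s * (2 * s) = m) :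
    IsAdmissible q m M (radialFunction 3 f) := by
  have hmeas : Measurable (radialFunction 3 f) := hf.comp measurable_norm
  have hM : 0 ≤ M := (hf0 0).trans (hfM 0 le_rfl)
  have hsupp : ∀ (p : E3 → ℝ), Continuous p →
      Integrable fun x => p x * radialFunction 3 f x := by
    intro p hp
    obtain ⟨C, hC⟩ := (isCompact_closedBall (0 : E3) R).exists_bound_of_continuousOn
      hp.continuousOn
    have hi : Integrable ((Metric.closedBall (0 : E3) R).indicator fun _ => C * M) :=
      (integrable_indicator_iff Metric.isClosed_closedBall.measurableSet).2
        (integrableOn_const (isCompact_closedBall _ _).measure_lt_top.ne)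
    refine hi.mono' (hp.measurable.mul hmeas).aestronglyMeasurable
      (Filter.Eventually.of_forall fun x => ?_)
    by_cases hx : x ∈ Metric.closedBall (0 : E3) R
    · rw [indicator_of_mem hx, norm_mul]
      exact mul_le_mul (hC x hx) (by
        rw [radialFunction, Real.norm_of_nonneg (hf0 _)]; exact hfM _ (norm_nonneg x)) (norm_nonneg _)
        ((norm_nonneg _).trans (hC x hx))
    · rw [indicator_of_notMem hx]
      have : R < ‖x‖ := by simpa using hx
      simp [radialFunction, hfR _ this]
  have habs : ∀ x, |radialFunction 3 f x| = radialFunction 3 f x := fun x =>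
    abs_of_nonneg (hf0 _)
  refine ⟨memMomentSpace_iff.2 ⟨?_, ?_⟩, Filter.Eventually.of_forall fun x => hf0 _,
    Filter.Eventually.of_forall fun x => ?_, ?_⟩
  · simpa using hsupp (fun _ => 1) continuous_const
  · simp only [habs]
    exact hsupp _ (by fun_prop)
  · rw [habs]; exact hfM _ (norm_nonneg x)
  · rw [integral_radialFunction hf hf0, hm]

/-- The odd powers come from the sphere integrals of the attractive part. The Newton term `2s / max
r s` is `2s / r` for `s ≤ r`, absorbed into `p₁`, and `2` beyond, which is `p₀`. -/
lemma integral_mul_quadratic_mul (α β p₀ p₁ p₃ p₅ a b : ℝ) :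
    ∫ s in a..b, s * (α + β * s ^ 2) * (p₅ * s ^ 5 + p₃ * s ^ 3 + p₁ * s + p₀) =
      (p₀ * (α * b ^ 2 / 2 + β * b ^ 4 / 4) + p₁ * (α * b ^ 3 / 3 + β * b ^ 5 / 5) +
        p₃ * (α * b ^ 5 / 5 + β * b ^ 7 / 7) + p₅ * (α * b ^ 7 / 7 + β * b ^ 9 / 9)) -
      (p₀ * (α * a ^ 2 / 2 + β * a ^ 4 / 4) + p₁ * (α * a ^ 3 / 3 + β * a ^ 5 / 5) +
        p₃ * (α * a ^ 5 / 5 + β * a ^ 7 / 7) + p₅ * (α * a ^ 7 / 7 + β * a ^ 9 / 9)) := by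
  have hp : ∀ (n : ℕ) (c s : ℝ), HasDerivAt (fun t => c * t ^ (n + 1) / ((n : ℝ) + 1))
      (c * s ^ n) s := fun n c s => by
    convert! ((hasDerivAt_pow (n + 1) s).const_mul c).div_const ((n : ℝ) + 1) using 1
    have : (n : ℝ) + 1 ≠ 0 := by positivity
    push_cast
    field_simp
  have hd : ∀ s ∈ uIcc a b, HasDerivAt (fun s => p₀ * (α * s ^ 2 / 2 + β * s ^ 4 / 4) +
      p₁ * (α * s ^ 3 / 3 + β * s ^ 5 / 5) +
      p₃ * (α * s ^ 5 / 5 + β * s ^ 7 / 7) + p₅ * (α * s ^ 7 / 7 + β * s ^ 9 / 9))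
      (s * (α + β * s ^ 2) * (p₅ * s ^ 5 + p₃ * s ^ 3 + p₁ * s + p₀)) s := fun s _ => by
    convert! (((((hp 1 α s).add (hp 3 β s)).const_mul p₀).add
      (((hp 2 α s).add (hp 4 β s)).const_mul p₁)).add
      (((hp 4 α s).add (hp 6 β s)).const_mul p₃)).add
      (((hp 6 α s).add (hp 8 β s)).const_mul p₅) using 1
    · ext t
      simp only [Pi.add_apply]
      norm_num
    · ring
  exact intervalIntegral.integral_eq_sub_of_hasDerivAt hd
    (Continuous.intervalIntegrable (by fun_prop) _ _)

/-- The mass of a density `α + β s²` cut off at radius `R`. -/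
lemma integral_Ioi_quadratic {f : ℝ → ℝ} {α β R : ℝ} (hR : 0 ≤ R)
    (hf : ∀ s, R < s → f s = 0) (hfg : ∀ s, s ≤ R → f s = α + β * s ^ 2) :
    ∫ s in Ioi 0, s * f s * (2 * s) = 2 * (α * R ^ 3 / 3 + β * R ^ 5 / 5) := by
  have h := integral_mul_quadratic_mul α β 0 2 0 0 0 R
  rw [intervalIntegral.integral_of_le hR] at h
  rw [setIntegral_eq_of_subset_of_forall_sdiff_eq_zero (s := Ioc 0 R) measurableSet_Ioi
    Ioc_subset_Ioi_self, setIntegral_congr_fun measurableSet_Ioc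
    (g := fun s => s * (α + β * s ^ 2) * (0 * s ^ 5 + 0 * s ^ 3 + 2 * s + 0)), h]
  · ring
  · intro s hs
    simp only [hfg s hs.2]
    ring
  · rintro s ⟨h1, h2⟩
    have : R < s := by
      by_contra h
      exact h2 ⟨h1, not_lt.1 h⟩
    simp [hf s this]

/-- The potential of a density `α + β s²` cut off at radius `R`. -/
lemma potential_quadratic {q : ℕ} {f : ℝ → ℝ} {α β R p₁ p₃ p₅ : ℝ} (hR : 0 ≤ R)
    (hfm : Measurable f) (hf0 : ∀ s, 0 ≤ f s)
    (hf : ∀ s, R < s → f s = 0) (hfg : ∀ s, s ≤ R → f s = α + β * s ^ 2) (x : E3)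
    (heq : ∀ s, 0 < s → ∫ t in (-s)..s, √(s ^ 2 + ‖x‖ ^ 2 - 2 * t * ‖x‖) ^ q / q =
      p₅ * s ^ 5 + p₃ * s ^ 3 + p₁ * s) :
    ∫ y : E3, kernelProfile q ‖x - y‖ * radialFunction 3 f y = 2 * Real.pi *
      (p₁ * (α * R ^ 3 / 3 + β * R ^ 5 / 5) + p₃ * (α * R ^ 5 / 5 + β * R ^ 7 / 7) +
        p₅ * (α * R ^ 7 / 7 + β * R ^ 9 / 9) +
      if ‖x‖ ≤ R then α * R ^ 2 + β * R ^ 4 / 2 - α * ‖x‖ ^ 2 / 3 - β * ‖x‖ ^ 4 / 10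
        else 2 / ‖x‖ * (α * R ^ 3 / 3 + β * R ^ 5 / 5)) := by
  have h := integral_kernelProfile_mul hfm hf0 (by fun_prop) x heq
  simp only [radialFunction]
  rw [h]
  congr 1
  set r := ‖x‖ with hr
  have hr0 : 0 ≤ r := norm_nonneg x
  by_cases hrR : r ≤ R
  · rw [if_pos hrR, integral_profile_inside hr0 hrR hf hfg (by fun_prop) (by fun_prop)]
    have e1 := integral_mul_quadratic_mul α β 0 (p₁ + 2 / r) p₃ p₅ 0 r
    have e2 := integral_mul_quadratic_mul α β 2 p₁ p₃ p₅ r R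
    have e3 : ∀ s : ℝ, p₅ * s ^ 5 + p₃ * s ^ 3 + p₁ * s + 2 * s / r =
        p₅ * s ^ 5 + p₃ * s ^ 3 + (p₁ + 2 / r) * s + 0 := fun s => by ring
    simp only [e3]
    rw [e1, e2]
    -- At `r = 0` the inner integral runs over a point, so the conventional value of `2 / r` does no
    -- harm.
    rcases hr0.eq_or_lt with h0 | h0
    · rw [← h0]; ring
    · field_simp
      ring
  · rw [if_neg hrR, integral_profile_outside hR (not_le.1 hrR).le hf]
    have e1 := integral_mul_quadratic_mul α β 0 (p₁ + 2 / r) p₃ p₅ 0 R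
    have e3 : ∀ s ∈ uIcc 0 R, s * f s * (p₅ * s ^ 5 + p₃ * s ^ 3 + p₁ * s + 2 * s / r) =
        s * (α + β * s ^ 2) * (p₅ * s ^ 5 + p₃ * s ^ 3 + (p₁ + 2 / r) * s + 0) := fun s hs => by
      rw [uIcc_of_le hR] at hs
      rw [hfg s hs.2]
      ring
    rw [intervalIntegral.integral_congr e3, e1]
    ring

/-! ### The case `q = 2`: uniform balls. -/

/-- The constant profile on the ball of radius `R`: height `c` for `r ≤ R`, and `0` beyond. -/
def ballProfile (c R r : ℝ) : ℝ := if r ≤ R then c else 0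

lemma measurable_ballProfile (c R : ℝ) : Measurable (ballProfile c R) :=
  Measurable.ite measurableSet_Iic measurable_const measurable_const

/-- For `q = 2`, a uniform ball of mass `m` is the minimizer if its radius is one, or if its
radius is larger and its height is maximal. -/
theorem isTheMinimizer_ballProfile {m M c R : ℝ} (hm : 0 < m) (hM : 0 < M) (hc : 0 ≤ c)
    (hcM : c ≤ M) (hR : R = 1 ∨ 1 ≤ R ∧ c = M) (hmass : 4 * Real.pi / 3 * R ^ 3 * c = m) :
    IsTheMinimizer (-1) 2 m M (radialFunction 3 (ballProfile c R)) := by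
  have hR1 : 1 ≤ R := by rcases hR with h | h; exacts [h.ge, h.1]
  have hR0 : 0 ≤ R := by linarith
  have hf0 : ∀ s, 0 ≤ ballProfile c R s := fun s => by
    unfold ballProfile; split_ifs <;> simp [hc]
  have hfM : ∀ s, 0 ≤ s → ballProfile c R s ≤ M := fun s _ => by
    unfold ballProfile; split_ifs; exacts [hcM, hM.le]
  have hfR : ∀ s, R < s → ballProfile c R s = 0 := fun s hs => by
    simp [ballProfile, not_le.2 hs]
  have hfg : ∀ s, s ≤ R → ballProfile c R s = c + 0 * s ^ 2 := fun s hs => by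
    simp [ballProfile, hs]
  have hadm : IsAdmissible (2 : ℕ) m M (radialFunction 3 (ballProfile c R)) := by
    refine isAdmissible_radialFunction (measurable_ballProfile c R) hf0 hfM hfR ?_
    rw [integral_Ioi_quadratic hR0 hfR hfg, ← hmass]
    ring
  have hR3 : 1 ≤ R ^ 3 := one_le_pow₀ hR1
  have key := isTheMinimizer_of_potential (q := 2) (Or.inl rfl) hm hM hadm
    (integral_radialFunction_coord _)
    -- The multiplier is the value of the potential on the sphere of radius `R`.
    (2 * Real.pi * (c * R ^ 5 / 5 + c * R ^ 2 + c * R ^ 2 * (R ^ 3 - 1) / 3)) ?_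
  · exact_mod_cast key
  intro v hv
  filter_upwards [hv.nonneg, hv.le_bound] with x hx0 hxM
  rw [potential_quadratic (q := 2) (p₁ := ‖x‖ ^ 2) (p₃ := 1) (p₅ := 0) hR0
    (measurable_ballProfile c R) hf0 hfR hfg x
    (fun s _ => (integral_sqrt_sq_div s ‖x‖).trans (by ring))]
  have hr0 : 0 ≤ ‖x‖ := norm_nonneg x
  set r := ‖x‖ with hr
  have hpi : 0 ≤ 2 * Real.pi := by positivity
  by_cases hrR : r ≤ R
  · rw [if_pos hrR, ← mul_sub]
    have hu : radialFunction 3 (ballProfile c R) x = c := by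
      simp [radialFunction, ballProfile, ← hr, hrR]
    rw [hu]
    -- Attraction and repulsion cancel exactly when `R = 1`, so the potential is then flat inside.
    -- For `R > 1` it lies below its boundary value, which is allowed because the density is
    -- saturated.
    have e : r ^ 2 * (c * R ^ 3 / 3 + 0 * R ^ 5 / 5) + 1 * (c * R ^ 5 / 5 + 0 * R ^ 7 / 7) +
        0 * (c * R ^ 7 / 7 + 0 * R ^ 9 / 9) +
        (c * R ^ 2 + 0 * R ^ 4 / 2 - c * r ^ 2 / 3 - 0 * r ^ 4 / 10) -
        (c * R ^ 5 / 5 + c * R ^ 2 + c * R ^ 2 * (R ^ 3 - 1) / 3) =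
        -(c * (R ^ 3 - 1) / 3 * (R ^ 2 - r ^ 2)) := by ring
    rw [e]
    rcases hR with h | ⟨-, h⟩
    · simp [h]
    · have h1 : 0 ≤ c * (R ^ 3 - 1) / 3 * (R ^ 2 - r ^ 2) :=
        mul_nonneg (by have : 0 ≤ R ^ 3 - 1 := by linarith
                       positivity) (by nlinarith)
      have h2 : v x ≤ c := by rw [h]; exact (le_abs_self _).trans hxM
      exact mul_nonneg_of_nonpos_of_nonpos (by nlinarith) (by linarith)
  · rw [if_neg hrR, ← mul_sub]
    have hrR' : R < r := not_le.1 hrR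
    have hu : radialFunction 3 (ballProfile c R) x = 0 := hfR _ hrR'
    rw [hu, sub_zero]
    have hrpos : 0 < r := hR0.trans_lt hrR'
    refine mul_nonneg (mul_nonneg hpi ?_) hx0
    -- Factoring out the root `r = R` leaves `R r (r + R) - 2`, nonnegative because `1 ≤ R < r`.
    have e : r ^ 2 * (c * R ^ 3 / 3 + 0 * R ^ 5 / 5) + 1 * (c * R ^ 5 / 5 + 0 * R ^ 7 / 7) +
        0 * (c * R ^ 7 / 7 + 0 * R ^ 9 / 9) +
        2 / r * (c * R ^ 3 / 3 + 0 * R ^ 5 / 5) -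
        (c * R ^ 5 / 5 + c * R ^ 2 + c * R ^ 2 * (R ^ 3 - 1) / 3) =
        c * R ^ 2 * (r - R) / (3 * r) * (R * r * (r + R) - 2) := by
      field_simp
      ring
    rw [e]
    have h1 : 0 ≤ r - R := by linarith
    have h2 : 1 ≤ R * r := one_le_mul_of_one_le_of_one_le hR1 (hR1.trans hrR'.le)
    have h3 : 0 ≤ R * r * (r + R) - 2 := by nlinarith
    positivity

lemma setOf_radialFunction_ballProfile_eq {c R : ℝ} (hc : c ≠ 0) :
    {x | radialFunction 3 (ballProfile c R) x = c} = Metric.closedBall (0 : E3) R := by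
  ext x
  simp only [radialFunction, ballProfile, mem_ofPred_eq, mem_closedBall_zero_iff]
  split_ifs with h <;> simp [h, hc.symm]

lemma volume_closedBall_E3 {R : ℝ} (hR : 0 ≤ R) :
    volume (Metric.closedBall (0 : E3) R) = ENNReal.ofReal (4 * Real.pi / 3 * R ^ 3) := by
  rw [Measure.addHaar_closedBall_eq_addHaar_ball, EuclideanSpace.volume_ball_fin_three,
    ← ENNReal.ofReal_pow hR, ← ENNReal.ofReal_mul (by positivity)]
  congr 1
  ring

lemma unitBallProfile_eq (c : ℝ) : unitBallProfile c = ballProfile c 1 := rfl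

lemma isTheMinimizer_unitBallProfile {m M : ℝ} (hm : 0 < m) (hM : 0 < M)
    (h : m / M ≤ 4 * Real.pi / 3) :
    IsTheMinimizer (-1) 2 m M
      (radialFunction 3 (unitBallProfile (3 * m / (4 * Real.pi)))) := by
  have hpi := Real.pi_pos
  rw [div_le_iff₀ hM] at h
  refine isTheMinimizer_ballProfile hm hM (by positivity) ?_ (Or.inl rfl) ?_
  · rw [div_le_iff₀ (by positivity)]
    linarith
  · field_simp

lemma isPhaseOne_unitBallProfile {m M : ℝ} (hM : 0 < M) (h : m / M < 4 * Real.pi / 3) :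
    IsPhaseOne M (radialFunction 3 (unitBallProfile (3 * m / (4 * Real.pi)))) := by
  have hpi := Real.pi_pos
  rw [div_lt_iff₀ hM] at h
  have hlt : 3 * m / (4 * Real.pi) < M := by
    rw [div_lt_iff₀ (by positivity)]
    linarith
  have : {x : E3 | radialFunction 3 (unitBallProfile (3 * m / (4 * Real.pi))) x = M} = ∅ := by
    refine eq_empty_of_forall_notMem fun x hx => ?_
    simp only [radialFunction, unitBallProfile, mem_ofPred_eq] at hx
    split_ifs at hx <;> linarith
  rw [IsPhaseOne, this, measure_empty]

lemma isPhaseThree_unitBallProfile {m M : ℝ} (hM : 0 < M) (h : m / M = 4 * Real.pi / 3) :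
    IsPhaseThree m M (radialFunction 3 (unitBallProfile (3 * m / (4 * Real.pi)))) := by
  have hpi := Real.pi_pos
  have hc : 3 * m / (4 * Real.pi) = M := by
    rw [div_eq_iff hM.ne'] at h
    rw [h]
    field_simp
  rw [IsPhaseThree, hc, unitBallProfile_eq, setOf_radialFunction_ballProfile_eq hM.ne',
    volume_closedBall_E3 zero_le_one, h]
  simp

/-- For `q = 2` the minimizer exists, and it is of phase one or three. -/
lemma exists_isTheMinimizer_two {m M : ℝ} (hm : 0 < m) (hM : 0 < M) :
    ∃ u : E3 → ℝ, IsTheMinimizer (-1) 2 m M u ∧ (IsPhaseOne M u ∨ IsPhaseThree m M u) := by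
  have hpi := Real.pi_pos
  rcases lt_trichotomy (m / M) (4 * Real.pi / 3) with h | h | h
  · exact ⟨_, isTheMinimizer_unitBallProfile hm hM h.le,
      Or.inl (isPhaseOne_unitBallProfile hM h)⟩
  · exact ⟨_, isTheMinimizer_unitBallProfile hm hM h.le,
      Or.inr (isPhaseThree_unitBallProfile hM h)⟩
  -- Beyond the threshold the saturated ball of volume `m / M` has radius `R = t^(1/3) ≥ 1`.
  · set t : ℝ := m / M / (4 * Real.pi / 3) with ht
    have ht1 : 1 ≤ t := by rw [ht, one_le_div (by positivity)]; exact h.le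
    set R : ℝ := t ^ (1 / 3 : ℝ) with hR
    have hR1 : 1 ≤ R := Real.one_le_rpow ht1 (by norm_num)
    have hR3 : R ^ 3 = t := by
      rw [hR, ← Real.rpow_natCast, ← Real.rpow_mul (by linarith)]
      norm_num
    refine ⟨radialFunction 3 (ballProfile M R), isTheMinimizer_ballProfile hm hM hM.le le_rfl
      (Or.inr ⟨hR1, rfl⟩) ?_, Or.inr ?_⟩
    · rw [hR3, ht]
      field_simp
    · rw [IsPhaseThree, setOf_radialFunction_ballProfile_eq hM.ne',
        volume_closedBall_E3 (by linarith), hR3, ht]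
      congr 1
      field_simp

lemma volume_setOf_eq_of_translate {u v : E3 → ℝ} {c : E3}
    (h : v =ᵐ[volume] fun x => u (x - c)) (M : ℝ) :
    volume {x | v x = M} = volume {x | u x = M} := by
  have h1 : ({x | v x = M} : Set E3) =ᵐ[volume] (fun x => x + -c) ⁻¹' {x | u x = M} := by
    filter_upwards [h] with x hx
    have : (v x = M) = (u (x + -c) = M) := by rw [hx, sub_eq_add_neg]
    exact this
  rw [measure_congr h1, measure_preimage_add_right]

/-- Uniqueness up to translation transfers the phase of the explicit minimizer to every other one.
-/
lemma not_isPhaseTwo_of_isMinimizer {m M : ℝ} (hm : 0 < m) (hM : 0 < M) {v : E3 → ℝ}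
    (hv : IsMinimizer (-1) 2 m M v) : ¬ IsPhaseTwo m M v := by
  obtain ⟨u, hu, hphase⟩ := exists_isTheMinimizer_two hm hM
  obtain ⟨c, hc⟩ := hu.2 v hv
  have hvol := volume_setOf_eq_of_translate hc M
  rintro ⟨h1, h2⟩
  rw [hvol] at h1 h2
  rcases hphase with h | h
  · exact h1.ne' h
  · exact h2.ne h

/-! ### The case `q = 4`: the quartic profile. -/

/-- The lower bound gives `a₀⁵ > 0`, the upper one `a₀⁵ < 1`. -/
lemma sqrt_twentyOne_bounds : 21 / 5 < √21 ∧ √21 < 5 := by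
  refine ⟨Real.lt_sqrt_of_sq_lt (by norm_num), (Real.sqrt_lt' (by norm_num)).2 (by norm_num)⟩

lemma quarticRadius_pos : 0 < quarticRadius :=
  Real.rpow_pos_of_pos (by linarith [sqrt_twentyOne_bounds.1]) _

lemma quarticRadius_pow_five : quarticRadius ^ 5 = (5 * √21 - 21) / 4 := by
  rw [quarticRadius, ← Real.rpow_natCast, ← Real.rpow_mul
    (by linarith [sqrt_twentyOne_bounds.1])]
  norm_num

lemma quarticRadius_equation :
    4 * quarticRadius ^ 10 + 42 * quarticRadius ^ 5 - 21 = 0 := by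
  have h : √21 ^ 2 = 21 := Real.sq_sqrt (by norm_num)
  rw [show quarticRadius ^ 10 = (quarticRadius ^ 5) ^ 2 by ring, quarticRadius_pow_five]
  linear_combination 25 / 4 * h

lemma quarticRadius_pow_five_lt_one : quarticRadius ^ 5 < 1 := by
  rw [quarticRadius_pow_five]
  linarith [sqrt_twentyOne_bounds.2]

/-- The constant coefficient of the quartic profile. -/
def quarticCoeff (a₃ : ℝ) : ℝ := a₃ * (3 - 3 * quarticRadius ^ 5) / (5 * quarticRadius ^ 3)

lemma quarticCoeff_pos {a₃ : ℝ} (h : 0 < a₃) : 0 < quarticCoeff a₃ := by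
  have := quarticRadius_pos
  have h1 : 0 < 3 - 3 * quarticRadius ^ 5 := by linarith [quarticRadius_pow_five_lt_one]
  unfold quarticCoeff
  positivity

lemma quarticProfile_of_le {a₃ s : ℝ} (hs : s ≤ quarticRadius) :
    quarticProfile a₃ s = quarticCoeff a₃ + a₃ * s ^ 2 := by
  have := quarticRadius_pos
  rw [quarticProfile, if_pos hs, quarticCoeff]
  field_simp

lemma quarticProfile_of_lt {a₃ s : ℝ} (hs : quarticRadius < s) : quarticProfile a₃ s = 0 := by
  rw [quarticProfile, if_neg (not_le.2 hs)]

lemma quarticProfile_nonneg {a₃ : ℝ} (h : 0 < a₃) (s : ℝ) : 0 ≤ quarticProfile a₃ s := by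
  rcases le_or_gt s quarticRadius with hs | hs
  · rw [quarticProfile_of_le hs]
    have := quarticCoeff_pos h
    positivity
  · rw [quarticProfile_of_lt hs]

lemma measurable_quarticProfile (a₃ : ℝ) : Measurable (quarticProfile a₃) := by
  unfold quarticProfile
  exact Measurable.ite measurableSet_Iic (by fun_prop) measurable_const

lemma quarticProfile_zero_pos {a₃ : ℝ} (h : 0 < a₃) : 0 < quarticProfile a₃ 0 := by
  rw [quarticProfile_of_le quarticRadius_pos.le]
  simpa using quarticCoeff_pos h

lemma strictMonoOn_quarticProfile {a₃ : ℝ} (h : 0 < a₃) :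
    StrictMonoOn (quarticProfile a₃) (Icc 0 quarticRadius) := by
  intro s hs t ht hst
  rw [quarticProfile_of_le hs.2, quarticProfile_of_le ht.2]
  have := pow_lt_pow_left₀ hst hs.1 two_ne_zero
  nlinarith

lemma quarticProfile_radius (a₃ : ℝ) : quarticProfile a₃ quarticRadius =
    a₃ * (2 * quarticRadius ^ 5 + 3) / (5 * quarticRadius ^ 3) := by
  rw [quarticProfile, if_pos le_rfl]
  ring

lemma quarticProfile_le_radius {a₃ s : ℝ} (h : 0 < a₃) (hs : 0 ≤ s) :
    quarticProfile a₃ s ≤ quarticProfile a₃ quarticRadius := by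
  rcases le_or_gt s quarticRadius with hs' | hs'
  · exact (strictMonoOn_quarticProfile h).monotoneOn ⟨hs, hs'⟩
      ⟨quarticRadius_pos.le, le_rfl⟩ hs'
  · rw [quarticProfile_of_lt hs']
    exact quarticProfile_nonneg h _

/-- The left side is `∫ s² u(s) ds`. Its value `a₃ / 5` cancels the `r⁴` term of the potential
inside the support, and it forces `a₃ = 5m / (4π)`. -/
lemma quarticProfile_second_moment (a₃ : ℝ) :
    quarticCoeff a₃ * quarticRadius ^ 3 / 3 + a₃ * quarticRadius ^ 5 / 5 = a₃ / 5 := by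
  have := quarticRadius_pos
  rw [quarticCoeff]
  field_simp
  ring

/-- The left side is `∫ s⁴ u(s) ds`. This value cancels the `r²` term of the potential, and is
equivalent to the equation for `a₀` when `a₃ ≠ 0`. -/
lemma quarticProfile_fourth_moment (a₃ : ℝ) :
    quarticCoeff a₃ * quarticRadius ^ 5 / 5 + a₃ * quarticRadius ^ 7 / 7 =
      quarticCoeff a₃ / 5 := by
  have h0 := quarticRadius_pos
  have h := quarticRadius_equation
  rw [quarticCoeff]
  field_simp
  linear_combination a₃ * h

lemma quarticProfile_radius_le {m M : ℝ} (hM : 0 < M)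
    (h : m / M ≤ 4 * Real.pi * quarticRadius ^ 3 / (2 * quarticRadius ^ 5 + 3)) :
    quarticProfile (5 * m / (4 * Real.pi)) quarticRadius ≤ M := by
  have h0 := quarticRadius_pos
  have hpi := Real.pi_pos
  rw [div_le_div_iff₀ hM (by positivity)] at h
  rw [quarticProfile_radius, div_le_iff₀ (by positivity), div_mul_eq_mul_div,
    div_le_iff₀ (by positivity)]
  linarith

/-- For `q = 4`, the quartic profile is the minimizer as long as its height is at most `M`. -/
theorem isTheMinimizer_quarticProfile {m M : ℝ} (hm : 0 < m) (hM : 0 < M)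
    (h : quarticProfile (5 * m / (4 * Real.pi)) quarticRadius ≤ M) :
    IsTheMinimizer (-1) 4 m M (radialFunction 3 (quarticProfile (5 * m / (4 * Real.pi)))) := by
  have hpi := Real.pi_pos
  have ha := quarticRadius_pos
  set b : ℝ := 5 * m / (4 * Real.pi) with hb
  have hb0 : 0 < b := by positivity
  have hf0 := quarticProfile_nonneg hb0
  have hfR : ∀ s, quarticRadius < s → quarticProfile b s = 0 := fun s => quarticProfile_of_lt
  have hfg : ∀ s, s ≤ quarticRadius → quarticProfile b s = quarticCoeff b + b * s ^ 2 :=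
    fun s => quarticProfile_of_le
  have m2 := quarticProfile_second_moment b
  have m4 := quarticProfile_fourth_moment b
  have hadm : IsAdmissible (4 : ℕ) m M (radialFunction 3 (quarticProfile b)) := by
    refine isAdmissible_radialFunction (measurable_quarticProfile b) hf0
      (fun s hs => (quarticProfile_le_radius hb0 hs).trans h) hfR ?_
    rw [integral_Ioi_quadratic ha.le hfR hfg, m2, hb]
    field_simp
    norm_num
  set α := quarticCoeff b with hα
  set a := quarticRadius with ha'
  have key := isTheMinimizer_of_potential (q := 4) (Or.inr rfl) hm hM hadm
    (integral_radialFunction_coord _)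
    -- The multiplier is what remains of the potential on the support once the `r²` and `r⁴` terms
    -- cancel.
    (2 * Real.pi * (1 / 2 * (α * a ^ 7 / 7 + b * a ^ 9 / 9) + α * a ^ 2 + b * a ^ 4 / 2)) ?_
  · exact_mod_cast key
  intro v hv
  filter_upwards [hv.nonneg] with x hx0
  rw [potential_quadratic (q := 4) (p₁ := ‖x‖ ^ 4 / 2) (p₃ := 5 / 3 * ‖x‖ ^ 2) (p₅ := 1 / 2)
    ha.le (measurable_quarticProfile b) hf0 hfR hfg x
    (fun s _ => (integral_sqrt_pow_four_div s ‖x‖).trans (by ring)), m2, m4]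
  have hr0 : 0 ≤ ‖x‖ := norm_nonneg x
  set r := ‖x‖ with hr
  by_cases hra : r ≤ a
  · rw [if_pos hra, ← mul_sub]
    refine le_of_eq (Eq.symm ?_)
    ring
  · rw [if_neg hra, ← mul_sub]
    have hra' : a < r := not_le.1 hra
    have hrpos : 0 < r := ha.trans hra'
    have hu : radialFunction 3 (quarticProfile b) x = 0 := hfR _ hra'
    rw [hu, sub_zero]
    refine mul_nonneg (mul_nonneg (by positivity) ?_) hx0
    -- The last factor is nondecreasing in `r` term by term, since `a⁵ < 1`, and it vanishes at `r =
    -- a`; so the potential outside is at least the multiplier.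
    have e : r ^ 4 / 2 * (b / 5) + 5 / 3 * r ^ 2 * (α / 5) +
        1 / 2 * (α * a ^ 7 / 7 + b * a ^ 9 / 9) + 2 / r * (b / 5) -
        (1 / 2 * (α * a ^ 7 / 7 + b * a ^ 9 / 9) + α * a ^ 2 + b * a ^ 4 / 2) =
        b * (r - a) * ((r + a) * (r ^ 2 + a ^ 2) / 10 + (1 - a ^ 5) * (r + a) / (5 * a ^ 3) -
          2 / (5 * (r * a))) := by
      rw [hα, quarticCoeff, ← ha']
      field_simp
      ring
    rw [e]
    have h1 : 0 ≤ 1 - a ^ 5 := by linarith [quarticRadius_pow_five_lt_one]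
    have h2 : (a + a) * (a ^ 2 + a ^ 2) / 10 ≤ (r + a) * (r ^ 2 + a ^ 2) / 10 := by gcongr
    have h3 : (1 - a ^ 5) * (a + a) / (5 * a ^ 3) ≤ (1 - a ^ 5) * (r + a) / (5 * a ^ 3) := by
      gcongr
    have h4 : 2 / (5 * (r * a)) ≤ 2 / (5 * (a * a)) := by gcongr
    have h5 : (a + a) * (a ^ 2 + a ^ 2) / 10 + (1 - a ^ 5) * (a + a) / (5 * a ^ 3) -
        2 / (5 * (a * a)) = 0 := by
      field_simp
      ring
    exact mul_nonneg (mul_nonneg hb0.le (by linarith)) (by linarith)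

/-- By strict monotonicity the value `M` can occur only on the sphere of radius `a₀`, which is a
null set. -/
lemma isPhaseOne_quarticProfile {a₃ M : ℝ} (h : 0 < a₃) (hM : 0 < M)
    (hle : quarticProfile a₃ quarticRadius ≤ M) :
    IsPhaseOne M (radialFunction 3 (quarticProfile a₃)) := by
  refine measure_mono_null (fun x hx => ?_)
    (Measure.addHaar_sphere volume (0 : E3) quarticRadius)
  have hx : quarticProfile a₃ ‖x‖ = M := hx
  rw [mem_sphere_zero_iff_norm]
  rcases lt_trichotomy ‖x‖ quarticRadius with h1 | h1 | h1
  · have := strictMonoOn_quarticProfile h ⟨norm_nonneg x, h1.le⟩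
      ⟨quarticRadius_pos.le, le_rfl⟩ h1
    linarith
  · exact h1
  · rw [quarticProfile_of_lt h1] at hx
    linarith

end

theorem mainTheorem8 :
    -- the case `n = 3`, `p = -1`, `q = 2`
    (∀ m M : ℝ, 0 < m → 0 < M →
      (m / M ≤ 4 * Real.pi / 3 →
        IsTheMinimizer (-1) 2 m M
          (radialFunction 3 (unitBallProfile (3 * m / (4 * Real.pi))))) ∧
      (m / M < 4 * Real.pi / 3 →
        IsPhaseOne M (radialFunction 3 (unitBallProfile (3 * m / (4 * Real.pi))))) ∧
      (m / M = 4 * Real.pi / 3 →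
        IsPhaseThree m M (radialFunction 3 (unitBallProfile (3 * m / (4 * Real.pi))))) ∧
      -- no phase 2, for any value of the ratio
      (∃ u : EuclideanSpace ℝ (Fin 3) → ℝ, IsMinimizer (-1) 2 m M u) ∧
      (∀ u : EuclideanSpace ℝ (Fin 3) → ℝ, IsMinimizer (-1) 2 m M u → ¬ IsPhaseTwo m M u)) ∧
    -- the case `n = 3`, `p = -1`, `q = 4`
    (0 < quarticRadius ∧
      quarticRadius ^ 5 = (5 * √21 - 21) / 4 ∧
      4 * quarticRadius ^ 10 + 42 * quarticRadius ^ 5 - 21 = 0 ∧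
      (∀ a₃ : ℝ, 0 < a₃ →
        0 < quarticProfile a₃ 0 ∧
        StrictMonoOn (quarticProfile a₃) (Icc 0 quarticRadius) ∧
        quarticProfile a₃ quarticRadius
          = a₃ * (2 * quarticRadius ^ 5 + 3) / (5 * quarticRadius ^ 3)) ∧
      (∀ m M : ℝ, 0 < m → 0 < M →
        m / M ≤ 4 * Real.pi * quarticRadius ^ 3 / (2 * quarticRadius ^ 5 + 3) →
        IsTheMinimizer (-1) 4 m M
          (radialFunction 3 (quarticProfile (5 * m / (4 * Real.pi)))) ∧
        IsPhaseOne M (radialFunction 3 (quarticProfile (5 * m / (4 * Real.pi)))))) := by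
  refine ⟨fun m M hm hM => ⟨isTheMinimizer_unitBallProfile hm hM, isPhaseOne_unitBallProfile hM,
      isPhaseThree_unitBallProfile hM, ?_, fun v hv => not_isPhaseTwo_of_isMinimizer hm hM hv⟩,
    quarticRadius_pos, quarticRadius_pow_five, quarticRadius_equation,
    fun a₃ h => ⟨quarticProfile_zero_pos h, strictMonoOn_quarticProfile h,
      quarticProfile_radius a₃⟩, fun m M hm hM h => ?_⟩
  · obtain ⟨u, hu, -⟩ := exists_isTheMinimizer_two hm hM
    exact ⟨u, hu.1⟩
  · have hle := quarticProfile_radius_le hM h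
    have hpi := Real.pi_pos
    exact ⟨isTheMinimizer_quarticProfile hm hM hle,
      isPhaseOne_quarticProfile (by positivity) hM hle⟩
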